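/- Let $d\ge 1$, let $L\ge 4$ be even, let $\Lambda=(\mathbb Z/L\mathbb Z)^d$ with its set $\mathscr B$ of unordered nearest-neighbour bonds, and let $\eta_x=(-1)^{x_1+\dots+x_d}$. Let $t,h,U\in\mathbb R$ with $|h|<U$. **Fermions.** On the fermionic Fock space over $\ell^2(\Lambda)\otimes\mathbb C^2$, with creation and annihilation operators $c^*_{x\sigma},c_{x\sigma}$ and $n_{x\sigma}=c_{x\sigma}^*c_{x\sigma}$, let $\mathcal H^{\rm hf}$ be the half-filled sector ($|\Lambda|$ particles), and on it put $$D=\sum_x n_{x\uparrow}n_{x\downarrow},\quad M=\tfrac12\sum_x\eta_x(n_{x\uparrow}-n_{x\downarrow}),\quad T=-t\sum_{\{x,y\}\in\mathscr B}\sum_\sigma(c_{x\sigma}^*c_{y\sigma}+c_{y\sigma}^*c_{x\sigma}).$$ Let $P_m$ be the spectral projection of $D$ at $m$ and $P=P_0$ (the singly occupied sector). For an operator $B$ let $B^{(k)}=\sum_m P_{m+k}BP_m$ and $B^{\rm off}=B-B^{(0)}$. Let $\mathcal I_h$ be the inverse of $X\mapsto[UD-hM,X]$ on $D$-off-diagonal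 operators: in the joint eigenbasis of $D$ and $M$ given by the occupation numbers, $\mathcal I_h$ divides each off-diagonal matrix entry by the difference of the eigenvalues of $UD-hM$ (entries for which that difference is $0$ are sent to $0$). **The LS/SW correction.** For $\xi\in\mathbb R$ put $B_0(\xi)=\xi T$, $S_n(\xi)=\mathcal I_h(B_n(\xi)^{\rm off})$ and $$B_{n+1}(\xi)=e^{S_n(\xi)}\bigl(UD-hM+B_n(\xi)\bigr)e^{-S_n(\xi)}-(UD-hM),$$ $B_\infty(\xi)=\lim_n B_n(\xi)$, $\Delta(h;\xi)=B_\infty(\xi)-\xi T^{(0)}$, and $H^{(2)}(h)=\frac12\frac{d^2}{d\xi^2}\Delta(h;\xi)\big|_{\xi=0}$. **Spins.** On $\mathcal H^{\rm spin}=\bigotimes_{x\in\Lambda}\mathbb C^2$ with spin-$\frac12$ operators $S_x^{(a)}$ let $$H^{\rm Heis}(J,h')=J\sum_{\{x,y\}\in\mathscr B}\Bigl(\sum_{a=1}^3S_x^{(a)}S_y^{(a)}-\tfrac14\Bigr)-h'\sum_x\eta_xS_x^{(3)}.$$ For any fixed ordering $x_1,\dots,x_{|\Lambda|}$ of $\Lambda$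 let $\mathcal U:P\mathcal H^{\rm hf}\to\mathcal H^{\rm spin}$ be the linear map that sends $c_{x_1\sigma_1}^*\cdots c_{x_{|\Lambda|}\sigma_{|\Lambda|}}^*|0\rangle$ to $|\sigma_1\rangle_{x_1}\otimes\cdots\otimes|\sigma_{|\Lambda|}\rangle_{x_{|\Lambda|}}$. **Claim.** The limit $B_\infty(\xi)$ exists for all sufficiently small $|\xi|$; $\Delta(h;\xi)$ is real-analytic at $\xi=0$, and its terms of order $0$ and $1$ vanish, so that $H^{(2)}(h)$ is its $\xi^2$-coefficient; if $UD-hM$ has no two occupation states with different values of $D$ and equal energy, then $\Delta(h;\xi)$ commutes with $D$ for all small $|\xi|$. The map $\mathcal U$ is unitary, and $$\mathcal U\,P\bigl(-hM+H^{(2)}(h)\bigr)P\,\mathcal U^*=H^{\rm Heis}\bigl(J(h),h_{\rm eff}(h)\bigr),\qquad J(h)=\frac{4t^2U}{U^2-h^2},\quad h_{\rm eff}(h)=h-\frac{4dht^2}{U^2-h^2}.$$ -/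

import Mathlib

open Filter Topology Matrix

noncomputable section

namespace Hubbard

/-! ### Fermionic Fock space over a finite ordered set of sites

A fermionic mode is a pair `(x, σ)`, with `σ = 0` for spin up and `σ = 1` for spin down.  The Fock
space over `ℓ²(V) ⊗ ℂ²` is represented in its orthonormal occupation basis: the finite set `s` of
modes stands for the wedge product of its elements in lexicographic order. Operators are complex
matrices in this basis, and `ᴴ` is the Hilbert space adjoint. -/

section Fock

variable {V : Type} [Fintype V] [LinearOrder V]

/-- Creation operator `c*_a`: wedge product with the mode `a` from the left. -/
def cdag (a : V × Fin 2) : Matrix (Finset (V × Fin 2)) (Finset (V × Fin 2)) ℂ :=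
  Matrix.of fun s' s =>
    if a ∉ s ∧ s' = insert a s then (-1) ^ (s.filter fun b => toLex b < toLex a).card else 0

/-- Annihilation operator `c_a`. -/
def cann (a : V × Fin 2) : Matrix (Finset (V × Fin 2)) (Finset (V × Fin 2)) ℂ :=
  (cdag a)ᴴ

/-- The vacuum vector. -/
def vacuum : Finset (V × Fin 2) → ℂ := Pi.single ∅ 1

/-- Occupation number operator `n_a = c*_a c_a`. -/
def num (a : V × Fin 2) : Matrix (Finset (V × Fin 2)) (Finset (V × Fin 2)) ℂ :=
  cdag a * cann a

/-- Occupation basis of the half-filled sector (as many particles as sites). -/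
abbrev HF (V : Type) [Fintype V] : Type :=
  {s : Finset (V × Fin 2) // s.card = Fintype.card V}

/-- Compression of a Fock space operator to the half-filled sector; for operators that conserve the
particle number this is the restriction. -/
def toHF (A : Matrix (Finset (V × Fin 2)) (Finset (V × Fin 2)) ℂ) : Matrix (HF V) (HF V) ℂ :=
  A.submatrix Subtype.val Subtype.val

/-- Double occupancy `D = ∑ₓ n_{x↑} n_{x↓}` on the half-filled sector. -/
def dblOcc : Matrix (HF V) (HF V) ℂ :=
  toHF (∑ x : V, num (x, 0) * num (x, 1))

/-- Staggered magnetisation `M = ∑ₓ ηₓ (n_{x↑} - n_{x↓}) / 2` on the half-filled sector. -/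
def stagMag (η : V → ℝ) : Matrix (HF V) (HF V) ℂ :=
  toHF (∑ x : V, (η x : ℂ) • ((1 / 2 : ℂ) • (num (x, 0) - num (x, 1))))

/-- Hopping term of the bond `{x, y}` with unit amplitude. -/
def bondHop : Sym2 V → Matrix (Finset (V × Fin 2)) (Finset (V × Fin 2)) ℂ :=
  Sym2.lift ⟨fun x y => ∑ σ : Fin 2, (cdag (x, σ) * cann (y, σ) + cdag (y, σ) * cann (x, σ)),
    fun _ _ => Finset.sum_congr rfl fun _ _ => add_comm _ _⟩

open scoped Classical in
/-- Hopping term `T = -t ∑_{x,y} ∑_σ (c*_{xσ} c_{yσ} + c*_{yσ} c_{xσ})`, the sum over the unordered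
bonds `{x, y}` of the graph `G`, on the half-filled sector. -/
def hopping (G : SimpleGraph V) (t : ℝ) : Matrix (HF V) (HF V) ℂ :=
  toHF ((-t : ℂ) • ∑ e ∈ G.edgeFinset, bondHop e)

/-- Unperturbed Hamiltonian `U D - h M`. -/
def freeHam (η : V → ℝ) (U h : ℝ) : Matrix (HF V) (HF V) ℂ :=
  (U : ℂ) • dblOcc - (h : ℂ) • stagMag η

/-! ### Grading by the double occupancy

`D` and `U D - h M` are diagonal in the occupation basis (`dblOcc_isDiag`, `freeHam_isDiag` below),
so their diagonal entries are their eigenvalues. -/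

/-- Spectral projection of `D` at the eigenvalue `m`. -/
def specProj (m : ℤ) : Matrix (HF V) (HF V) ℂ :=
  Matrix.diagonal fun s => if dblOcc s s = (m : ℂ) then 1 else 0

/-- The component `B^(k) = ∑_{m ≥ 0} P_{m+k} B P_m` of grade `k`. -/
def gradedPart (k : ℤ) (B : Matrix (HF V) (HF V) ℂ) : Matrix (HF V) (HF V) ℂ :=
  ∑ m ∈ Finset.range (Fintype.card V + 1), specProj ((m : ℤ) + k) * B * specProj (m : ℤ)

/-- The off-diagonal part `B^off = B - B^(0) = ∑_{k ≠ 0} B^(k)`. -/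
def offPart (B : Matrix (HF V) (HF V) ℂ) : Matrix (HF V) (HF V) ℂ :=
  B - gradedPart 0 B

/-- The homological inverse: `invAd η U h B` is the image of `B^off` under the inverse of the
commutator with `U D - h M` on the `D`-off-diagonal operators.  In the joint eigenbasis of `D` and
`M` this divides the matrix entries by the energy differences.  See `commutator_invAd` for the
inverse property and `invAd_hasSum` for the Neumann series in `h`. -/
def invAd (η : V → ℝ) (U h : ℝ) (B : Matrix (HF V) (HF V) ℂ) : Matrix (HF V) (HF V) ℂ :=
  Matrix.of fun s s' =>
    if dblOcc s s = dblOcc s' s' then 0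
    else B s s' / (freeHam η U h s s - freeHam η U h s' s')

/-! ### The Lie-Schwinger / Schrieffer-Wolff iteration -/

/-- The iterates `Bₙ` for the Hamiltonian `U D - h M + ξ T`: `B₀ = ξ T`, and with `Sₙ` the
homological inverse of the off-diagonal part of `Bₙ`,
`U D - h M + Bₙ₊₁ = exp Sₙ (U D - h M + Bₙ) exp (-Sₙ)`. -/
def lsIter (G : SimpleGraph V) (η : V → ℝ) (U t h ξ : ℝ) : ℕ → Matrix (HF V) (HF V) ℂ
  | 0 => (ξ : ℂ) • hopping G t
  | n + 1 =>
      NormedSpace.exp (invAd η U h (lsIter G η U t h ξ n)) *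
          (freeHam η U h + lsIter G η U t h ξ n) *
          NormedSpace.exp (-invAd η U h (lsIter G η U t h ξ n)) -
        freeHam η U h

/-- The limit `B_∞(h; ξ)` of the iteration. -/
def lsLimit (G : SimpleGraph V) (η : V → ℝ) (U t h ξ : ℝ) : Matrix (HF V) (HF V) ℂ :=
  limUnder atTop (lsIter G η U t h ξ)

/-- The diagonal correction `Δ(h; ξ) = B_∞(h; ξ) - ξ T^(0)`. -/
def lsCorrection (G : SimpleGraph V) (η : V → ℝ) (U t h ξ : ℝ) : Matrix (HF V) (HF V) ℂ :=
  lsLimit G η U t h ξ - (ξ : ℂ) • gradedPart 0 (hopping G t)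

/-- The second-order effective term `H^(2)(h) = (1/2) d²/dξ² Δ(h; ξ)` at `ξ = 0`. -/
def secondOrder (G : SimpleGraph V) (η : V → ℝ) (U t h : ℝ) : Matrix (HF V) (HF V) ℂ :=
  Matrix.of fun s s' => (1 / 2 : ℂ) * iteratedDeriv 2 (fun ξ : ℝ => lsCorrection G η U t h ξ s s') 0

/-! ### The spin system

The spin space is the tensor product of one `ℂ²` for each site, with the orthonormal basis
`V → Fin 2`. -/

/-- The Pauli matrices. -/
def pauli : Fin 3 → Matrix (Fin 2) (Fin 2) ℂ :=
  ![!![0, 1; 1, 0], !![0, -Complex.I; Complex.I, 0], !![1, 0; 0, -1]]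

/-- The spin operator `S_x^(a)`: half a Pauli matrix on the tensor factor at `x`, the identity on
all others. -/
def spinOp (a : Fin 3) (x : V) : Matrix (V → Fin 2) (V → Fin 2) ℂ :=
  Matrix.of fun σ τ => if ∀ y, y ≠ x → σ y = τ y then (1 / 2 : ℂ) * pauli a (σ x) (τ x) else 0

/-- `S_x · S_y` (symmetrised, so that it is manifestly a function of the unordered bond; the two
orders agree because the operators commute for `x ≠ y`). -/
def spinDot : Sym2 V → Matrix (V → Fin 2) (V → Fin 2) ℂ :=
  Sym2.lift ⟨fun x y =>
      (1 / 2 : ℂ) • ∑ a : Fin 3, (spinOp a x * spinOp a y + spinOp a y * spinOp a x),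
    fun _ _ => congrArg _ (Finset.sum_congr rfl fun _ _ => add_comm _ _)⟩

open scoped Classical in
/-- The Heisenberg Hamiltonian `J ∑_{x,y} (S_x · S_y - 1/4) - h ∑ₓ ηₓ S_x^(3)`, the first sum over
the unordered bonds `{x, y}` of `G`. -/
def heisenberg (G : SimpleGraph V) (η : V → ℝ) (J h : ℝ) : Matrix (V → Fin 2) (V → Fin 2) ℂ :=
  (J : ℂ) • ∑ e ∈ G.edgeFinset, (spinDot e - (1 / 4 : ℂ) • 1) -
    (h : ℂ) • ∑ x : V, (η x : ℂ) • spinOp 2 x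

/-- The singly occupied state `c*_{x₁σ₁} ⋯ c*_{x_Nσ_N} |0⟩`, where `x₁ < ⋯ < x_N` are the sites. -/
def spinState (σ : V → Fin 2) : Finset (V × Fin 2) → ℂ :=
  (((Finset.univ : Finset V).sort (· ≤ ·)).map fun x => cdag (x, σ x)).prod *ᵥ vacuum

/-- The spin identification: the partial isometry that sends the singly occupied state with spins
`σ` to the basis vector `σ` of the spin space and vanishes on the orthogonal complement of these
states in the half-filled sector. -/
def spinIdent : Matrix (V → Fin 2) (HF V) ℂ :=
  Matrix.of fun σ s => star (spinState σ s.1)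

end Fock

/-! ### The torus -/

/-- The discrete torus `(ℤ/L)^d`. -/
abbrev Torus (d L : ℕ) : Type := Fin d → ZMod L

/-- Nearest neighbours: distinct sites that differ by a unit vector. -/
def torusGraph (d L : ℕ) : SimpleGraph (Torus d L) :=
  SimpleGraph.fromRel fun x y => ∃ i : Fin d, y = x + Pi.single i 1

/-- The staggering `ηₓ = (-1)^(x₁ + ⋯ + x_d)` (for even `L`). -/
def stagger (d L : ℕ) (x : Torus d L) : ℝ := (-1) ^ ∑ i, (x i).val

/-! ### Basic properties of the definitions -/

section Facts

set_option linter.unusedSectionVars false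

variable {V : Type} [Fintype V] [LinearOrder V]

/-- The sign of `c*_a` on the basis vector `s`. -/
def sgn (a : V × Fin 2) (s : Finset (V × Fin 2)) : ℂ :=
  (-1) ^ (s.filter fun b => toLex b < toLex a).card

lemma sgn_mul_self (a : V × Fin 2) (s : Finset (V × Fin 2)) : sgn a s * sgn a s = 1 := by
  simp [sgn, ← mul_pow]

lemma sgn_insert (a b : V × Fin 2) (s : Finset (V × Fin 2)) (hb : b ∉ s) :
    sgn a (insert b s) = (if toLex b < toLex a then -1 else 1) * sgn a s := by
  unfold sgn
  rw [Finset.filter_insert]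
  split_ifs with h
  · rw [Finset.card_insert_of_notMem (by simp [hb]), pow_succ]; ring
  · simp

lemma cdag_apply (a : V × Fin 2) (s' s : Finset (V × Fin 2)) :
    cdag a s' s = if a ∉ s ∧ s' = insert a s then sgn a s else 0 := rfl

lemma cann_apply (a : V × Fin 2) (s' s : Finset (V × Fin 2)) :
    cann a s' s = cdag a s s' := by
  simp only [cann, Matrix.conjTranspose_apply, cdag_apply, sgn]
  split_ifs <;> simp

lemma mul_cdag_apply (A : Matrix (Finset (V × Fin 2)) (Finset (V × Fin 2)) ℂ) (b : V × Fin 2)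
    (s' s : Finset (V × Fin 2)) :
    (A * cdag b) s' s = if b ∉ s then A s' (insert b s) * sgn b s else 0 := by
  rw [Matrix.mul_apply]
  by_cases hb : b ∈ s
  · simp [cdag_apply, hb]
  · rw [Finset.sum_eq_single (insert b s)]
    · simp [cdag_apply, hb]
    · intro u _ hu; simp [cdag_apply, hu]
    · simp

lemma mul_cann_apply (A : Matrix (Finset (V × Fin 2)) (Finset (V × Fin 2)) ℂ) (a : V × Fin 2)
    (s' s : Finset (V × Fin 2)) :
    (A * cann a) s' s = if a ∈ s then A s' (s.erase a) * sgn a (s.erase a) else 0 := by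
  rw [Matrix.mul_apply]
  by_cases ha : a ∈ s
  · rw [Finset.sum_eq_single (s.erase a)]
    · simp [cann_apply, cdag_apply, ha, Finset.insert_erase]
    · intro u _ hu
      have : ¬ (a ∉ u ∧ s = insert a u) := by
        rintro ⟨h1, rfl⟩; exact hu (Finset.erase_insert h1).symm
      simp [cann_apply, cdag_apply, this]
    · simp
  · have : ∀ u, ¬ (a ∉ u ∧ s = insert a u) := by
      rintro u ⟨_, rfl⟩; exact ha (Finset.mem_insert_self _ _)
    simp [cann_apply, cdag_apply, this, ha]

/-- Canonical anticommutation relations, first part. -/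
lemma cdag_anticomm (a b : V × Fin 2) : cdag a * cdag b + cdag b * cdag a = 0 := by
  ext s' s
  simp only [Matrix.add_apply, mul_cdag_apply, cdag_apply, Matrix.zero_apply, Finset.mem_insert,
    not_or]
  rcases eq_or_ne a b with rfl | hab
  · simp
  by_cases ha : a ∈ s
  · simp [ha]
  by_cases hb : b ∈ s
  · simp [hb]
  rw [Finset.insert_comm b a]
  by_cases hs : s' = insert a (insert b s)
  · simp only [ha, hb, hs, hab, hab.symm, not_false_eq_true, and_self, if_true,
      sgn_insert a b s hb, sgn_insert b a s ha]
    rcases lt_trichotomy (toLex a) (toLex b) with h | h | h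
    · simp [h, h.not_gt]; ring
    · exact absurd (toLex.injective h) hab
    · simp [h, h.not_gt]; ring
  · simp [hs]

/-- Canonical anticommutation relations, second part. -/
lemma cann_anticomm (a b : V × Fin 2) : cann a * cann b + cann b * cann a = 0 := by
  have h := congrArg Matrix.conjTranspose (cdag_anticomm b a)
  simpa [cann, Matrix.conjTranspose_mul] using h

/-- Canonical anticommutation relations, third part. -/
lemma cann_cdag_anticomm (a b : V × Fin 2) :
    cann a * cdag b + cdag b * cann a = if a = b then 1 else 0 := by
  ext s' s
  simp only [Matrix.add_apply, mul_cdag_apply, mul_cann_apply, cann_apply, cdag_apply]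
  rcases eq_or_ne a b with rfl | hab
  · by_cases ha : a ∈ s
    · by_cases hs : s' = s
      · subst hs; simp [ha, Finset.insert_erase, sgn_mul_self]
      · simp [ha, Finset.insert_erase, hs]
    · by_cases hs : s' = s
      · subst hs; simp [ha, sgn_mul_self]
      · have : ¬ (a ∉ s' ∧ insert a s = insert a s') := by
          rintro ⟨h1, h2⟩
          apply hs
          rw [← Finset.erase_insert h1, ← h2, Finset.erase_insert ha]
        simp [ha, this, hs]
  · simp only [hab, if_false, Matrix.zero_apply]
    by_cases hb : b ∈ s
    · simp [hb, Ne.symm hab]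
    by_cases ha : a ∈ s
    · by_cases hs : s' = insert b (s.erase a)
      · subst hs
        have h1 : a ∉ insert b (s.erase a) := by simp [hab]
        have h2 : insert b s = insert a (insert b (s.erase a)) := by
          rw [Finset.insert_comm, Finset.insert_erase ha]
        have h3 : b ∉ s.erase a := by simp [hb]
        have h4 : sgn b s = (if toLex a < toLex b then -1 else 1) * sgn b (s.erase a) := by
          conv_lhs => rw [← Finset.insert_erase ha]
          exact sgn_insert b a _ (by simp)
        simp only [hb, ha, h1, h2, h3, not_false_eq_true, and_self, if_true, h4,
          sgn_insert a b _ h3]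
        rcases lt_trichotomy (toLex a) (toLex b) with h | h | h
        · simp [h, h.not_gt]; ring
        · exact absurd (toLex.injective h) hab
        · simp [h, h.not_gt]; ring
      · have : ¬ (a ∉ s' ∧ insert b s = insert a s') := by
          rintro ⟨h1, h2⟩
          apply hs
          rw [← Finset.erase_insert h1, ← h2, Finset.erase_insert_of_ne (Ne.symm hab)]
        simp [hs, this]
    · have : ¬ (a ∉ s' ∧ insert b s = insert a s') := by
        rintro ⟨_, h2⟩
        have : a ∈ insert b s := h2 ▸ Finset.mem_insert_self a s'
        simp [hab, ha] at this
      simp [ha, this]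

lemma num_eq (a : V × Fin 2) : num a = Matrix.diagonal fun s => if a ∈ s then 1 else 0 := by
  ext s' s
  simp only [num, mul_cann_apply, cdag_apply, Matrix.diagonal_apply]
  by_cases ha : a ∈ s
  · simp only [ha, Finset.notMem_erase, not_false_eq_true, Finset.insert_erase, true_and, if_true]
    by_cases hs : s' = s
    · simp [hs, ha, sgn_mul_self]
    · simp [hs]
  · by_cases hs : s' = s
    · simp [hs, ha]
    · simp [hs, ha]

/-- `D` is diagonal and counts the doubly occupied sites. -/
lemma dblOcc_eq : (dblOcc : Matrix (HF V) (HF V) ℂ) = Matrix.diagonal fun s =>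
    ((Finset.univ.filter fun x : V => (x, (0 : Fin 2)) ∈ s.1 ∧ (x, (1 : Fin 2)) ∈ s.1).card : ℂ) := by
  ext s s'
  simp only [dblOcc, toHF, Matrix.submatrix_apply, Matrix.sum_apply, num_eq,
    Matrix.diagonal_mul_diagonal, Matrix.diagonal_apply, Subtype.val_inj]
  by_cases hs : s = s'
  · subst hs
    rw [Finset.card_filter]
    push_cast
    simp only [if_true]
    refine Finset.sum_congr rfl fun x _ => ?_
    by_cases h0 : (x, (0 : Fin 2)) ∈ s.1 <;> by_cases h1 : (x, (1 : Fin 2)) ∈ s.1 <;> simp [h0, h1]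
  · simp [hs]

lemma dblOcc_isDiag : (dblOcc : Matrix (HF V) (HF V) ℂ).IsDiag := by
  rw [dblOcc_eq]; exact Matrix.isDiag_diagonal _

lemma stagMag_isDiag (η : V → ℝ) : (stagMag η).IsDiag := by
  intro s s' hs
  have : s.1 ≠ s'.1 := fun h => hs (Subtype.ext h)
  simp [stagMag, toHF, Matrix.sum_apply, num_eq, this]

lemma freeHam_isDiag (η : V → ℝ) (U h : ℝ) : (freeHam η U h).IsDiag := by
  intro s s' hs
  simp [freeHam, dblOcc_isDiag hs, stagMag_isDiag η hs]

lemma isDiag_mul_apply {A : Matrix (HF V) (HF V) ℂ} (hA : A.IsDiag) (B : Matrix (HF V) (HF V) ℂ)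
    (s s' : HF V) : (A * B) s s' = A s s * B s s' := by
  rw [Matrix.mul_apply, Finset.sum_eq_single s]
  · intro u _ hu; simp [hA hu.symm]
  · simp

lemma mul_isDiag_apply {A : Matrix (HF V) (HF V) ℂ} (hA : A.IsDiag) (B : Matrix (HF V) (HF V) ℂ)
    (s s' : HF V) : (B * A) s s' = B s s' * A s' s' := by
  rw [Matrix.mul_apply, Finset.sum_eq_single s']
  · intro u _ hu; simp [hA hu]
  · simp

/-- The graded part of grade `k` consists of the entries that raise `D` by `k`. -/
lemma gradedPart_apply (k : ℤ) (B : Matrix (HF V) (HF V) ℂ) (s s' : HF V) :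
    gradedPart k B s s' = if dblOcc s s = dblOcc s' s' + (k : ℂ) then B s s' else 0 := by
  simp only [gradedPart, Matrix.sum_apply, specProj, Matrix.mul_diagonal, Matrix.diagonal_mul]
  obtain ⟨m, hm, hm'⟩ : ∃ m ∈ Finset.range (Fintype.card V + 1), dblOcc s' s' = (m : ℂ) := by
    refine ⟨_, ?_, by rw [dblOcc_eq, Matrix.diagonal_apply_eq]⟩
    exact Finset.mem_range.2 (Nat.lt_succ_of_le (Finset.card_le_univ _))
  rw [Finset.sum_eq_single m]
  · simp [hm']
  · intro u _ hu
    have : (m : ℂ) ≠ u := by exact_mod_cast hu.symm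
    simp [hm', this]
  · exact fun h => absurd hm h

/-- `invAd` inverts the commutator with `U D - h M` on the off-diagonal operators, provided that no
energy denominator vanishes where it is needed. -/
lemma commutator_invAd (η : V → ℝ) (U h : ℝ) (B : Matrix (HF V) (HF V) ℂ)
    (hB : ∀ s s', dblOcc s s ≠ dblOcc s' s' → B s s' ≠ 0 →
      freeHam η U h s s ≠ freeHam η U h s' s') :
    freeHam η U h * invAd η U h B - invAd η U h B * freeHam η U h = offPart B := by
  ext s s'
  rw [Matrix.sub_apply, isDiag_mul_apply (freeHam_isDiag η U h),
    mul_isDiag_apply (freeHam_isDiag η U h), offPart, Matrix.sub_apply, gradedPart_apply]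
  simp only [invAd, Matrix.of_apply, Int.cast_zero, add_zero]
  by_cases hd : dblOcc s s = dblOcc s' s'
  · simp [hd]
  · by_cases h0 : B s s' = 0
    · simp [h0]
    · have := sub_ne_zero.2 (hB s s' hd h0)
      simp only [hd, if_false, sub_zero]
      field_simp

/-- On operators `A` of grade `k ≠ 0`, `invAd` is the sum of the Neumann series
`(kU)⁻¹ ∑ₙ (h / (kU))ⁿ ad_Mⁿ A` if `|h| |m - m'| < |k| U` for the eigenvalues `m`, `m'` of `M` that
`A` connects. -/
lemma invAd_hasSum (η : V → ℝ) (U h : ℝ) (hU : 0 < U) (k : ℤ) (hk : k ≠ 0)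
    (A : Matrix (HF V) (HF V) ℂ) (hA : gradedPart k A = A)
    (hsmall : ∀ s s', A s s' ≠ 0 →
      |h| * ‖stagMag η s s - stagMag η s' s'‖ < |(k : ℝ)| * U) :
    HasSum (fun n : ℕ => ((k * U : ℂ)⁻¹ * (h / (k * U)) ^ n) •
      (fun X : Matrix (HF V) (HF V) ℂ => stagMag η * X - X * stagMag η)^[n] A)
      (invAd η U h A) := by
  have hkU : (k * U : ℂ) ≠ 0 := by
    simp [hk, hU.ne']
  have hiter : ∀ (n : ℕ) (s s' : HF V),
      ((fun X : Matrix (HF V) (HF V) ℂ => stagMag η * X - X * stagMag η)^[n] A) s s' =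
        (stagMag η s s - stagMag η s' s') ^ n * A s s' := by
    intro n
    induction n with
    | zero => simp
    | succ n ih =>
      intro s s'
      rw [Function.iterate_succ_apply', Matrix.sub_apply, isDiag_mul_apply (stagMag_isDiag η),
        mul_isDiag_apply (stagMag_isDiag η), ih]
      ring
  refine Pi.hasSum.2 fun s => Pi.hasSum.2 fun s' => ?_
  simp only [Matrix.smul_apply, hiter, smul_eq_mul]
  by_cases h0 : A s s' = 0
  · simp [h0, invAd]
  have hgr : dblOcc s s = dblOcc s' s' + (k : ℂ) := by
    by_contra hne
    have := gradedPart_apply k A s s'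
    rw [hA, if_neg hne] at this
    exact h0 this
  have hne : dblOcc s s ≠ dblOcc s' s' := by
    rw [hgr]; simp [hk]
  set m : ℂ := stagMag η s s - stagMag η s' s' with hm
  have hE : freeHam η U h s s - freeHam η U h s' s' = k * U - h * m := by
    simp only [freeHam, Matrix.sub_apply, Matrix.smul_apply, smul_eq_mul, hgr, hm]
    ring
  have hr : ‖(h : ℂ) / (k * U) * m‖ < 1 := by
    have hpos : 0 < |(k : ℝ)| * U := by
      have : (k : ℝ) ≠ 0 := by exact_mod_cast hk
      positivity
    have e : ‖(h : ℂ) / (k * U) * m‖ = |h| * ‖m‖ / (|(k : ℝ)| * U) := by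
      simp only [norm_mul, norm_div, Complex.norm_real, Complex.norm_intCast, Real.norm_eq_abs,
        abs_of_pos hU]
      ring
    rw [e, div_lt_one hpos]
    exact hsmall s s' h0
  have hg := (hasSum_geometric_of_norm_lt_one hr).mul_left ((k * U : ℂ)⁻¹ * A s s')
  have hval : invAd η U h A s s' = (k * U : ℂ)⁻¹ * A s s' * (1 - (h : ℂ) / (k * U) * m)⁻¹ := by
    simp only [invAd, Matrix.of_apply, hne, if_false, hE]
    have : (k * U - h * m : ℂ) = (k * U) * (1 - (h : ℂ) / (k * U) * m) := by
      have hc : (k * U : ℂ) * ((h : ℂ) / (k * U)) = h := mul_div_cancel₀ _ hkU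
      linear_combination m * hc
    rw [this, div_eq_mul_inv, mul_inv]
    ring
  rw [hval]
  have hfun : (fun n : ℕ => (k * U : ℂ)⁻¹ * (h / (k * U)) ^ n * (m ^ n * A s s')) =
      fun n : ℕ => (k * U : ℂ)⁻¹ * A s s' * ((h : ℂ) / (k * U) * m) ^ n := by
    funext n
    rw [mul_pow]
    ring
  rw [hfun]
  exact hg

end Facts

end Hubbard

end

open Hubbard

/-!
The iteration is studied in a complex Banach algebra.  Write `K` for the unperturbed Hamiltonian,
`I` for the homological inverse and `Q` for the projection with `[K, I B] = Q B`; for the Hubbard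
model `Q` keeps the matrix entries that change both `D` and the energy, so that the entries with a
vanishing denominator cause no harm.  One step maps `B` to `B - Q B` up to an error
`O(‖Q B‖ ‖B‖)` (`conjStep_linear_isBigO`).  Hence `‖Q B‖` is at least halved in every step near
`0`, while `‖B‖ + 4 ‖Q B‖` does not increase: the iterates converge geometrically, uniformly for
complex couplings in a disc, and the limit satisfies `Q B = 0` (`exists_iterLimit_bound`) and is
analytic in the coupling (`analyticAt_iterLimit_smul`).  If there are no resonances, `Q B = 0` says
that `B` commutes with `D`.  Since `Q Bₙ` is of order `n + 1` in the coupling, two steps determine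
the limit up to an error of third order:
`B - Q B + (1 - Q) ([I B, B] - [I B, Q B] / 2)` (`iterLimit_isBigO`).

The hopping operator `T` is never resonant.  A hop that changes `D` changes it by `± 1`, and on a
bipartite graph it changes `M` by `± 1`, so the energy changes by `± U ± h ≠ 0`
(`energy_ne_of_hopSum_ne_zero`).  This identifies the first order term of the limit with `T^(0)`,
and between singly occupied states the second order term is the sum over intermediate states `u` of
`-(1/2) T_{σu} T_{uτ} ((E_u - E_σ)⁻¹ + (E_u - E_τ)⁻¹)` (`quadCoeff_occHF_apply`).

A hop from `y` to `x` is possible only if the spins at `x` and `y` are antiparallel; it leads to a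
state in which `x` is the only doubly occupied and `y` the only empty site. Therefore the particle
that returns goes from `x` to `y`, and the result is the initial state or the one with the two spins
exchanged, with opposite signs (`hopSet_eq_hopSet`, `hopSgn_swapSpin`).  With
`a = ηₓ σ_y = ± 1` the energy differences are `U - h a` for the initial state and `U + h a` for the
exchanged one.  As `(U - h a)⁻¹ = (U + h a) / (U² - h²)`, the part even in `h` gives the exchange
coupling, and the odd part gives a term proportional to `a = -(ηₓ σₓ + η_y σ_y) / 2`, which sums to
a staggered field because every site has `2 d` neighbours (`hop_contribution`,
`spinIdent_effective_eq_heisenberg`).  The ordered product of creation operators acts on the vacuum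
without a sign, so the spin identification only relabels the basis (`spinState_eq`).
-/

noncomputable section

set_option linter.unusedSectionVars false

namespace Hubbard

open Asymptotics

/-! ### Convergence and expansion of the iteration in a Banach algebra -/

section Iteration

/-- One step of the iteration: conjugation of `K + B` by the exponential of `I B`, with the
unperturbed part `K` subtracted. -/
def conjStep {A : Type*} [Ring A] [TopologicalSpace A] [IsTopologicalRing A] (K : A) (I : A → A)
    (B : A) : A :=
  NormedSpace.exp (I B) * (K + B) * NormedSpace.exp (-I B) - K

/-- `I` inverts the commutator with `K` on the range of the projection `Q` and vanishes on the
kernel of `Q`. -/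
structure IsHomologicalInverse {A : Type*} [Ring A] (K : A) (I Q : A → A) : Prop where
  commutator : ∀ B, K * I B - I B * K = Q B
  idem : ∀ B, Q (Q B) = Q B
  apply_proj : ∀ B, I (Q B) = I B

variable {A : Type*} [NormedRing A] [NormedAlgebra ℂ A] [CompleteSpace A]

lemma differentiable_exp : Differentiable ℂ (NormedSpace.exp : A → A) := fun x =>
  (NormedSpace.exp_analytic (𝕂 := ℂ) x).differentiableAt

lemma exp_sub_linear_isBigO :
    (fun x : A => NormedSpace.exp x - 1 - x) =O[𝓝 0] fun x => ‖x‖ ^ 2 := by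
  have h := (NormedSpace.exp_hasFPowerSeriesAt_zero (𝕂 := ℂ)
    (𝔸 := A)).isBigO_sub_partialSum_pow 2
  refine h.congr_left fun x => ?_
  simp [FormalMultilinearSeries.partialSum, Finset.sum_range_succ,
    NormedSpace.expSeries_apply_eq, sub_sub]

lemma exp_sub_quadratic_isBigO :
    (fun x : A => NormedSpace.exp x - 1 - x - (1 / 2 : ℂ) • (x * x)) =O[𝓝 0]
      fun x => ‖x‖ ^ 3 := by
  have h := (NormedSpace.exp_hasFPowerSeriesAt_zero (𝕂 := ℂ)
    (𝔸 := A)).isBigO_sub_partialSum_pow 3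
  refine h.congr_left fun x => ?_
  simp [FormalMultilinearSeries.partialSum, Finset.sum_range_succ,
    NormedSpace.expSeries_apply_eq, sub_sub, Nat.factorial, pow_two, add_assoc]

variable {K : A} {I Q : A →L[ℂ] A}

/-- The quadratic term of one step of the iteration: `[I B, B] - [I B, Q B] / 2`. -/
def quadTerm {A : Type*} [Ring A] [Algebra ℂ A] (I Q : A → A) (B : A) : A :=
  (I B * B - B * I B) - (1 / 2 : ℂ) • (I B * Q B - Q B * I B)

lemma tendsto_clm_zero (J : A →L[ℂ] A) : Tendsto J (𝓝 0) (𝓝 0) := by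
  simpa using J.continuous.tendsto 0

lemma clm_isBigO_norm (J : A →L[ℂ] A) (l : Filter A) : (fun B => J B) =O[l] fun B => ‖B‖ :=
  (J.isBigO_id l).norm_right

lemma IsHomologicalInverse.isBigO_proj (hI : IsHomologicalInverse K I Q) (l : Filter A) :
    (fun B => I B) =O[l] fun B => ‖Q B‖ :=
  ((I.isBigO_comp Q l).congr_left fun B => hI.apply_proj B).norm_right

/-- One step removes `Q B` up to an error that is small relative to `Q B`. -/
lemma conjStep_linear_isBigO (hI : IsHomologicalInverse K I Q) :
    (fun B => conjStep K I B - (B - Q B)) =O[𝓝 0] fun B => ‖Q B‖ * ‖B‖ := by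
  have hS := tendsto_clm_zero I
  have hSN := clm_isBigO_norm I (𝓝 0)
  have hSW := hI.isBigO_proj (𝓝 0)
  have hSS : (fun B => ‖I B‖ ^ 2) =O[𝓝 0] fun B => ‖Q B‖ * ‖B‖ := by
    simpa only [pow_two] using hSW.norm_left.mul hSN.norm_left
  have ha := (exp_sub_linear_isBigO.comp_tendsto hS).trans hSS
  have hS' : Tendsto (fun B => -I B) (𝓝 0) (𝓝 0) := by simpa using hS.neg
  have hb := (exp_sub_linear_isBigO.comp_tendsto hS').trans
    ((hSS.congr_left fun B => by simp))
  have hcont : ContinuousAt (fun B : A => (1 + I B) * (K + B)) 0 := by fun_prop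
  have hexp : Continuous (NormedSpace.exp : A → A) := differentiable_exp.continuous
  have hcont2 : ContinuousAt (fun B : A => (K + B) * NormedSpace.exp (-I B)) 0 := by fun_prop
  have hcont3 : ContinuousAt (fun B : A => (K + B)) 0 := by fun_prop
  have h1 := hcont.isBigO_one ℝ
  have h2 := hcont2.isBigO_one ℝ
  have h3 := hcont3.isBigO_one ℝ
  have hid : (fun B : A => B) =O[𝓝 0] fun B => ‖B‖ := (isBigO_refl _ _).norm_right
  -- With `S = I B`, `a = exp S - 1 - S` and `b = exp (-S) - 1 + S`, the remainder is
  -- `S B - B S + (1 + S) (K + B) b - S (K + B) S + a (K + B) exp (-S)`.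
  have t1 := hSW.mul hid
  have t2 := (hid.mul hSW).congr_right fun B => mul_comm _ _
  have t3 := (h1.mul hb).congr_right fun B => one_mul _
  have t4 := ((hSW.mul h3).mul hSN).congr_right fun B => by rw [mul_one]
  have t5 := (ha.mul h2).congr_right fun B => mul_one _
  refine ((((t1.sub t2).add t3).sub t4).add t5).congr_left fun B => ?_
  simp only [Function.comp, conjStep, ← hI.commutator]
  noncomm_ring

/-- Second order expansion of one step. -/
lemma conjStep_quadratic_isBigO (hI : IsHomologicalInverse K I Q) :
    (fun B => conjStep K I B - (B - Q B + quadTerm I Q B)) =O[𝓝 0] fun B => ‖B‖ ^ 3 := by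
  have hS := tendsto_clm_zero I
  have hSN := clm_isBigO_norm I (𝓝 0)
  have hS' : Tendsto (fun B => -I B) (𝓝 0) (𝓝 0) := by simpa using hS.neg
  have ha := (exp_sub_quadratic_isBigO.comp_tendsto hS).trans (hSN.norm_left.pow 3)
  have hb := (exp_sub_quadratic_isBigO.comp_tendsto hS').trans
    ((hSN.norm_left.pow 3).congr_left fun B => by simp)
  have hb2 := (exp_sub_linear_isBigO.comp_tendsto hS').trans
    ((hSN.norm_left.pow 2).congr_left fun B => by simp)
  have hexp : Continuous (NormedSpace.exp : A → A) := differentiable_exp.continuous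
  have hcont2 : ContinuousAt (fun B : A => (K + B) * NormedSpace.exp (-I B)) 0 := by fun_prop
  have hcont3 : ContinuousAt (fun B : A => (K + B)) 0 := by fun_prop
  have h2 := hcont2.isBigO_one ℝ
  have h3 := hcont3.isBigO_one ℝ
  have hid : (fun B : A => B) =O[𝓝 0] fun B => ‖B‖ := (isBigO_refl _ _).norm_right
  have hone : (fun B : A => ‖B‖ ^ 2) =O[𝓝 0] fun B => ‖B‖ := by
    have : ContinuousAt (fun B : A => ‖B‖) 0 := by fun_prop
    simpa [pow_two] using (isBigO_refl (fun B : A => ‖B‖) (𝓝 0)).mul (this.isBigO_one ℝ)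
  have hb1 : (fun B => NormedSpace.exp (-I B) - 1) =O[𝓝 0] fun B => ‖B‖ :=
    ((hb2.trans hone).sub hSN).congr_left fun B => by simp [Function.comp]
  -- The commutator with `K` turns half of the quadratic part of the exponentials into
  -- `-[I B, Q B] / 2`; the terms `t1`, ..., `t7` below add up to the remainder.
  have t1 := (((hSN.mul hSN).mul hid).const_smul_left (1 / 2 : ℂ)).congr_right
    fun B => show _ = ‖B‖ ^ 3 by ring
  have t2 := ((hSN.mul hid).mul hSN).congr_right fun B => show _ = ‖B‖ ^ 3 by ring
  have t3 := (((hid.mul hSN).mul hSN).const_smul_left (1 / 2 : ℂ)).congr_right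
    fun B => show _ = ‖B‖ ^ 3 by ring
  have t4 := (h3.mul hb).congr_right fun B => one_mul _
  have t5 := ((hSN.mul h3).mul hb2).congr_right fun B => show _ = ‖B‖ ^ 3 by ring
  have t6 := (ha.mul h2).congr_right fun B => mul_one _
  have t7 := ((((hSN.mul hSN).mul h3).mul hb1).const_smul_left (1 / 2 : ℂ)).congr_right
    fun B => show _ = ‖B‖ ^ 3 by ring
  refine ((((((t1.sub t2).add t3).add t4).add t5).add t6).add t7).congr_left fun B => ?_
  simp only [Function.comp, Pi.smul_apply, conjStep, quadTerm, ← hI.commutator]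
  simp only [mul_sub, sub_mul, mul_add, add_mul, smul_sub, smul_add, Algebra.mul_smul_comm,
    Algebra.smul_mul_assoc, neg_mul, mul_neg, neg_neg, mul_one, one_mul, mul_assoc,
    sub_neg_eq_add]
  module

lemma conjStep_differentiable : Differentiable ℂ (conjStep K I) := by
  have hexp := differentiable_exp (A := A)
  unfold conjStep
  fun_prop

/-- Near `0` the iterates form a geometrically convergent sequence, at a rate governed by the
component `Q B` of the initial value.  The function `‖B‖ + 4 ‖Q B‖` does not increase along the
iteration, so the iterates stay in the region where the error estimate applies. -/
lemma exists_iterate_bound (hI : IsHomologicalInverse K I Q) :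
    ∃ r > 0, ∀ B : A, ‖B‖ ≤ r → ∀ n : ℕ,
      ‖Q ((conjStep K I)^[n] B)‖ ≤ (1 / 2) ^ n * ‖Q B‖ ∧
      ‖(conjStep K I)^[n + 1] B - (conjStep K I)^[n] B‖ ≤ 2 * ((1 / 2) ^ n * ‖Q B‖) := by
  obtain ⟨C, hC, hbound⟩ := (conjStep_linear_isBigO hI).exists_pos
  obtain ⟨δ, hδ, hball⟩ := Metric.eventually_nhds_iff.1 hbound.bound
  set q := ‖Q‖ with hq
  have hq0 : 0 ≤ q := norm_nonneg _
  obtain ⟨ρ, hρ, hρδ, hρC, hρq⟩ : ∃ ρ > 0, ρ < δ ∧ C * ρ ≤ 1 ∧ q * (C * ρ) ≤ 1 / 2 := by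
    have h0 : Tendsto (fun ρ : ℝ => C * ρ) (𝓝[>] 0) (𝓝 0) := by
      have : Tendsto (fun ρ : ℝ => C * ρ) (𝓝 0) (𝓝 (C * 0)) :=
        (continuous_const.mul continuous_id).tendsto 0
      rw [mul_zero] at this
      exact this.mono_left nhdsWithin_le_nhds
    have h1 : Tendsto (fun ρ : ℝ => q * (C * ρ)) (𝓝[>] 0) (𝓝 0) := by
      simpa using h0.const_mul q
    obtain ⟨ρ, ⟨⟨hρC, hρq⟩, hρδ⟩, hρ⟩ := (((h0.eventually (ge_mem_nhds zero_lt_one)).and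
      (h1.eventually (ge_mem_nhds (by norm_num : (0 : ℝ) < 1 / 2)))).and
      (nhdsWithin_le_nhds (gt_mem_nhds hδ))).and self_mem_nhdsWithin |>.exists
    exact ⟨ρ, hρ, hρδ, hρC, hρq⟩
  have step : ∀ B : A, ‖B‖ ≤ ρ →
      ‖Q (conjStep K I B)‖ ≤ 1 / 2 * ‖Q B‖ ∧ ‖conjStep K I B - B‖ ≤ 2 * ‖Q B‖ := by
    intro B hB
    have h := hball (show dist B 0 < δ by rw [dist_zero_right]; exact hB.trans_lt hρδ)
    rw [norm_mul, norm_norm, norm_norm] at h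
    have hCB : C * ‖B‖ ≤ C * ρ := mul_le_mul_of_nonneg_left hB hC.le
    have h' : ‖conjStep K I B - (B - Q B)‖ ≤ C * ρ * ‖Q B‖ := by
      calc _ ≤ C * ‖B‖ * ‖Q B‖ := by rw [mul_assoc, mul_comm ‖B‖]; exact h
        _ ≤ _ := mul_le_mul_of_nonneg_right hCB (norm_nonneg _)
    constructor
    · have e : Q (conjStep K I B) = Q (conjStep K I B - (B - Q B)) := by
        simp [map_sub, hI.idem]
      rw [e]
      calc _ ≤ q * ‖conjStep K I B - (B - Q B)‖ := Q.le_opNorm _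
        _ ≤ q * (C * ρ * ‖Q B‖) := mul_le_mul_of_nonneg_left h' hq0
        _ = q * (C * ρ) * ‖Q B‖ := by ring
        _ ≤ _ := mul_le_mul_of_nonneg_right hρq (norm_nonneg _)
    · have e : conjStep K I B - B = (conjStep K I B - (B - Q B)) - Q B := by abel
      rw [e]
      calc _ ≤ ‖conjStep K I B - (B - Q B)‖ + ‖Q B‖ := norm_sub_le _ _
        _ ≤ C * ρ * ‖Q B‖ + ‖Q B‖ := by gcongr
        _ ≤ 1 * ‖Q B‖ + ‖Q B‖ := by gcongr
        _ = _ := by ring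
  refine ⟨ρ / (1 + 4 * q), by positivity, fun B hB => ?_⟩
  have hV : ∀ n : ℕ, ‖(conjStep K I)^[n] B‖ + 4 * ‖Q ((conjStep K I)^[n] B)‖ ≤ ρ ∧
      ‖Q ((conjStep K I)^[n] B)‖ ≤ (1 / 2) ^ n * ‖Q B‖ := by
    intro n
    induction n with
    | zero =>
      refine ⟨?_, by simp⟩
      have : ‖Q B‖ ≤ q * ‖B‖ := Q.le_opNorm _
      rw [le_div_iff₀ (by positivity)] at hB
      simp only [Function.iterate_zero, id]
      linarith
    | succ n ih =>
      rw [Function.iterate_succ_apply']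
      set X := (conjStep K I)^[n] B
      have hX : ‖X‖ ≤ ρ := by linarith [norm_nonneg (Q X), ih.1]
      obtain ⟨s1, s2⟩ := step X hX
      have s3 : ‖conjStep K I X‖ ≤ ‖X‖ + ‖conjStep K I X - X‖ := norm_le_insert' _ _
      refine ⟨by linarith [ih.1], s1.trans ?_⟩
      calc _ ≤ 1 / 2 * ((1 / 2) ^ n * ‖Q B‖) := by gcongr; exact ih.2
        _ = _ := by ring
  intro n
  refine ⟨(hV n).2, ?_⟩
  rw [Function.iterate_succ_apply']
  have := step _ (show ‖(conjStep K I)^[n] B‖ ≤ ρ by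
    linarith [norm_nonneg (Q ((conjStep K I)^[n] B)), (hV n).1])
  exact this.2.trans (by gcongr; exact (hV n).2)

/-- The limit of the iteration, on the neighbourhood of `0` where it converges. -/
def iterLimit (K : A) (I : A → A) (B : A) : A :=
  limUnder atTop fun n => (conjStep K I)^[n] B

/-- Uniform convergence of the iteration near `0`. -/
lemma exists_iterLimit_bound (hI : IsHomologicalInverse K I Q) :
    ∃ r > 0, ∀ B : A, ‖B‖ ≤ r →
      Tendsto (fun n => (conjStep K I)^[n] B) atTop (𝓝 (iterLimit K I B)) ∧
      Q (iterLimit K I B) = 0 ∧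
      ∀ n : ℕ, ‖iterLimit K I B - (conjStep K I)^[n] B‖ ≤ 4 * ‖Q B‖ * (1 / 2) ^ n := by
  obtain ⟨r, hr, h⟩ := exists_iterate_bound hI
  refine ⟨r, hr, fun B hB => ?_⟩
  have hd : ∀ n, dist ((conjStep K I)^[n] B) ((conjStep K I)^[n + 1] B) ≤
      2 * ‖Q B‖ * (1 / 2) ^ n := fun n => by
    rw [dist_comm, dist_eq_norm]
    exact ((h B hB n).2).trans (le_of_eq (by ring))
  have hlim : Tendsto (fun n => (conjStep K I)^[n] B) atTop (𝓝 (iterLimit K I B)) :=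
    (cauchySeq_of_le_geometric (1 / 2) _ (by norm_num) hd).tendsto_limUnder
  refine ⟨hlim, ?_, fun n => ?_⟩
  · have h1 : Tendsto (fun n => Q ((conjStep K I)^[n] B)) atTop (𝓝 (Q (iterLimit K I B))) :=
      (Q.continuous.tendsto _).comp hlim
    have h2 : Tendsto (fun n : ℕ => (1 / 2 : ℝ) ^ n * ‖Q B‖) atTop (𝓝 0) := by
      simpa using (tendsto_pow_atTop_nhds_zero_of_lt_one (r := (1 / 2 : ℝ)) (by norm_num)
        (by norm_num)).mul_const ‖Q B‖
    exact tendsto_nhds_unique h1 (squeeze_zero_norm (fun n => (h B hB n).1) h2)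
  · rw [← dist_eq_norm, dist_comm]
    refine (dist_le_of_le_geometric_of_tendsto _ _ (by norm_num) hd hlim n).trans (le_of_eq ?_)
    ring

/-- Second order expansion of the limit.  Two steps of the iteration leave only an error of third
order, because each step multiplies the size of the component in the range of `Q` by `O(‖B‖)`. -/
lemma iterLimit_isBigO (hI : IsHomologicalInverse K I Q) :
    (fun B => iterLimit K I B - (B - Q B + (quadTerm I Q B - Q (quadTerm I Q B)))) =O[𝓝 0]
      fun B => ‖B‖ ^ 3 := by
  obtain ⟨r, hr, hlim⟩ := exists_iterLimit_bound hI
  have hsmall : ∀ᶠ B : A in 𝓝 0, ‖B‖ ≤ r := by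
    filter_upwards [Metric.closedBall_mem_nhds (0 : A) hr] with B hB
    simpa using hB
  set Φ := conjStep K I with hΦ
  have hΦ0 : Φ 0 = 0 := by simp [hΦ, conjStep]
  have hΦt : Tendsto Φ (𝓝 0) (𝓝 0) := by
    have h : Tendsto Φ (𝓝 0) (𝓝 (Φ 0)) :=
      (conjStep_differentiable (K := K) (I := I)).continuous.tendsto 0
    rwa [hΦ0] at h
  have hlin := conjStep_linear_isBigO hI
  rw [← hΦ] at hlin
  have hWN := clm_isBigO_norm Q (𝓝 0)
  have hid : (fun B : A => B) =O[𝓝 0] fun B => ‖B‖ := (isBigO_refl _ _).norm_right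
  have hone : (fun B : A => ‖B‖) =O[𝓝 0] fun _ => (1 : ℝ) := by
    have : ContinuousAt (fun B : A => ‖B‖) 0 := by fun_prop
    exact this.isBigO_one ℝ
  have hΦN : Φ =O[𝓝 0] fun B => ‖B‖ := by
    have h1 : (fun B : A => ‖Q B‖ * ‖B‖) =O[𝓝 0] fun B => ‖B‖ := by
      simpa using (hWN.norm_left.trans hone).mul (isBigO_refl (fun B : A => ‖B‖) (𝓝 0))
    exact ((hlin.trans h1).add (hid.sub hWN)).congr_left fun B => by abel
  have hQΦ : (fun B => Q (Φ B)) =O[𝓝 0] fun B => ‖Q B‖ * ‖B‖ :=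
    ((Q.isBigO_comp (fun B => Φ B - (B - Q B)) (𝓝 0)).trans hlin).congr_left fun B => by
      simp [map_sub, hI.idem]
  have hQΦ2 : (fun B => Q (Φ B)) =O[𝓝 0] fun B => ‖B‖ ^ 2 :=
    hQΦ.trans ((hWN.norm_left.mul (isBigO_refl _ _)).congr_right fun B => by ring)
  have hQΦΦ : (fun B => ‖Q (Φ B)‖ * ‖Φ B‖) =O[𝓝 0] fun B => ‖B‖ ^ 3 :=
    (hQΦ2.norm_left.mul hΦN.norm_left).congr_right fun B => by ring
  have e1 : (fun B => iterLimit K I (Φ (Φ B)) - Φ (Φ B)) =O[𝓝 0] fun B => ‖B‖ ^ 3 := by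
    have h1 : (fun B => iterLimit K I B - B) =O[𝓝 0] fun B => ‖Q B‖ := by
      refine IsBigO.of_bound 4 ?_
      filter_upwards [hsmall] with B hB
      simpa using (hlim B hB).2.2 0
    refine (h1.comp_tendsto (hΦt.comp hΦt)).trans ?_
    exact ((hQΦ.comp_tendsto hΦt).norm_left).trans hQΦΦ
  have e2 : (fun B => Φ (Φ B) - (Φ B - Q (Φ B))) =O[𝓝 0] fun B => ‖B‖ ^ 3 :=
    (hlin.comp_tendsto hΦt).trans hQΦΦ
  have e3 := conjStep_quadratic_isBigO hI
  rw [← hΦ] at e3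
  have e4 := (Q.isBigO_comp (fun B => Φ B - (B - Q B + quadTerm I Q B)) (𝓝 0)).trans e3
  refine (((e1.add e2).add e3).sub e4).congr' ?_ EventuallyEq.rfl
  filter_upwards [hsmall, (hΦt.comp hΦt).eventually hsmall] with B hB hB2
  have hshift : iterLimit K I (Φ (Φ B)) = iterLimit K I B := by
    refine tendsto_nhds_unique (hlim _ hB2).1 ?_
    have := ((hlim B hB).1).comp (tendsto_add_atTop_nat 2)
    exact this
  simp only [hshift, map_sub, map_add, hI.idem]
  abel

/-- The limit depends analytically on a complex coupling constant. -/
lemma analyticAt_iterLimit_smul (hI : IsHomologicalInverse K I Q) (T : A) :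
    AnalyticAt ℂ (fun ξ : ℂ => iterLimit K I (ξ • T)) 0 := by
  obtain ⟨r, hr, hlim⟩ := exists_iterLimit_bound hI
  set s : Set ℂ := {ξ | ‖ξ • T‖ < r} with hs
  have hso : IsOpen s := isOpen_lt (by fun_prop) continuous_const
  have hs0 : (0 : ℂ) ∈ s := by simpa [hs] using hr
  have hu : TendstoUniformlyOn (fun n (ξ : ℂ) => (conjStep K I)^[n] (ξ • T))
      (fun ξ => iterLimit K I (ξ • T)) atTop s := by
    rw [Metric.tendstoUniformlyOn_iff]
    intro ε hε
    have h2 : Tendsto (fun n : ℕ => 4 * (‖Q‖ * r) * (1 / 2 : ℝ) ^ n) atTop (𝓝 0) := by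
      simpa using (tendsto_pow_atTop_nhds_zero_of_lt_one (r := (1 / 2 : ℝ)) (by norm_num)
        (by norm_num)).const_mul (4 * (‖Q‖ * r))
    filter_upwards [h2.eventually (gt_mem_nhds hε)] with n hn ξ hξ
    rw [dist_eq_norm]
    have hξ' : ‖ξ • T‖ ≤ r := le_of_lt hξ
    refine ((hlim _ hξ').2.2 n).trans_lt (lt_of_le_of_lt ?_ hn)
    gcongr
    exact (Q.le_opNorm _).trans (by gcongr)
  refine DifferentiableOn.analyticAt (hu.tendstoLocallyUniformlyOn.differentiableOn
    (Eventually.of_forall fun n => ?_) hso) (hso.mem_nhds hs0)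
  have hn : Differentiable ℂ ((conjStep K I)^[n]) := by
    induction n with
    | zero => exact differentiable_id
    | succ n ih => rw [Function.iterate_succ]; exact ih.comp conjStep_differentiable
  exact (hn.comp (differentiable_id.smul_const T)).differentiableOn

/-- Second order expansion of the limit in the coupling constant. -/
lemma iterLimit_smul_isBigO (hI : IsHomologicalInverse K I Q) (T : A) :
    (fun ξ : ℂ => iterLimit K I (ξ • T) - (ξ • (T - Q T) +
      ξ ^ 2 • (quadTerm I Q T - Q (quadTerm I Q T)))) =O[𝓝 0] fun ξ => ‖ξ‖ ^ 3 := by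
  have htend : Tendsto (fun ξ : ℂ => ξ • T) (𝓝 0) (𝓝 0) := by
    have : Continuous fun ξ : ℂ => ξ • T := by fun_prop
    simpa using this.tendsto 0
  have hT : (fun ξ : ℂ => ‖ξ • T‖ ^ 3) =O[𝓝 0] fun ξ => ‖ξ‖ ^ 3 := by
    refine IsBigO.of_bound (‖T‖ ^ 3) (Eventually.of_forall fun ξ => ?_)
    rw [norm_smul, norm_pow, norm_mul, norm_pow, norm_norm, norm_norm, mul_pow, mul_comm]
  refine (((iterLimit_isBigO hI).comp_tendsto htend).trans hT).congr_left fun ξ => ?_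
  have hquad : quadTerm I Q (ξ • T) = ξ ^ 2 • quadTerm I Q T := by
    simp only [quadTerm, map_smul, smul_mul_smul_comm]
    module
  simp only [Function.comp, hquad, map_smul]
  module

end Iteration

/-! ### Taylor coefficients -/

section Taylor

/-- An analytic function that is `O(x ^ n)` at `0` vanishes there to order `n`. -/
lemma natCast_le_analyticOrderAt_of_isBigO {g : ℝ → ℂ} (hg : AnalyticAt ℝ g 0) {n : ℕ}
    (hO : g =O[𝓝 0] fun x => ‖x‖ ^ n) : (n : ℕ∞) ≤ analyticOrderAt g 0 := by
  by_contra hlt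
  rw [not_le] at hlt
  obtain ⟨k, hk, hk0, hgk⟩ := hg.analyticOrderAt_ne_top.1 hlt.ne_top
  set m := analyticOrderNatAt g 0 with hm
  have hmn : m < n := by
    have : (m : ℕ∞) = analyticOrderAt g 0 := Nat.cast_analyticOrderNatAt hlt.ne_top
    rw [← this] at hlt
    exact_mod_cast hlt
  obtain ⟨C, hC⟩ := hO.bound
  have hle : ∀ᶠ x : ℝ in 𝓝[≠] 0, ‖k x‖ ≤ C * ‖x‖ ^ (n - m) := by
    filter_upwards [nhdsWithin_le_nhds hC, nhdsWithin_le_nhds hgk, self_mem_nhdsWithin]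
      with x h1 h2 (hx : x ≠ 0)
    have hx' : 0 < ‖x‖ ^ m := pow_pos (norm_pos_iff.2 hx) _
    rw [h2, norm_smul, norm_pow, norm_pow, norm_norm, sub_zero] at h1
    refine le_of_mul_le_mul_left (h1.trans (le_of_eq ?_)) hx'
    rw [mul_left_comm, ← pow_add, Nat.add_sub_cancel' hmn.le]
  have h0 : Tendsto (fun x : ℝ => C * ‖x‖ ^ (n - m)) (𝓝[≠] 0) (𝓝 0) := by
    have : Continuous fun x : ℝ => C * ‖x‖ ^ (n - m) := by fun_prop
    have h := this.tendsto 0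
    simp only [norm_zero, zero_pow (Nat.sub_ne_zero_of_lt hmn), mul_zero] at h
    exact h.mono_left nhdsWithin_le_nhds
  exact hk0 (tendsto_nhds_unique (hk.continuousAt.tendsto.mono_left nhdsWithin_le_nhds)
    (squeeze_zero_norm' hle h0))

/-- The first Taylor coefficients of an analytic function of order two. -/
lemma taylor_two_of_isBigO {f : ℝ → ℂ} (hf : AnalyticAt ℝ f 0) (a : ℂ)
    (hO : (fun x : ℝ => f x - (x : ℂ) ^ 2 * a) =O[𝓝 0] fun x => ‖x‖ ^ 3) :
    f 0 = 0 ∧ deriv f 0 = 0 ∧ (1 / 2 : ℂ) * iteratedDeriv 2 f 0 = a := by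
  have hq : ∀ x : ℝ, HasDerivAt (fun x : ℝ => (x : ℂ) ^ 2 * a) (2 * (x : ℂ) * a) x := fun x => by
    simpa using ((Complex.ofRealCLM.hasDerivAt (x := x)).pow 2).mul_const a
  have hq2 : ∀ x : ℝ, HasDerivAt (fun x : ℝ => 2 * (x : ℂ) * a) (2 * a) x := fun x => by
    simpa using ((Complex.ofRealCLM.hasDerivAt (x := x)).const_mul 2).mul_const a
  have hqa : AnalyticAt ℝ (fun x : ℝ => (x : ℂ) ^ 2 * a) 0 :=
    ((Complex.ofRealCLM.analyticAt 0).pow 2).mul analyticAt_const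
  have hga := hf.sub hqa
  have h := (natCast_le_analyticOrderAt_iff_iteratedDeriv_eq_zero hga).1
    (natCast_le_analyticOrderAt_of_isBigO hga hO)
  have hsub : ∀ i, iteratedDeriv i (f - fun x : ℝ => (x : ℂ) ^ 2 * a) 0 =
      iteratedDeriv i f 0 - iteratedDeriv i (fun x : ℝ => (x : ℂ) ^ 2 * a) 0 := fun i =>
    iteratedDeriv_sub hf.contDiffAt hqa.contDiffAt
  have d1 : deriv (fun x : ℝ => (x : ℂ) ^ 2 * a) = fun x : ℝ => 2 * (x : ℂ) * a :=
    funext fun x => (hq x).deriv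
  have h0 := h 0 (by norm_num)
  have h1 := h 1 (by norm_num)
  have h2 := h 2 (by norm_num)
  rw [hsub] at h0 h1 h2
  rw [iteratedDeriv_succ' (n := 1) (f := fun x : ℝ => (x : ℂ) ^ 2 * a), d1] at h2
  simp only [iteratedDeriv_zero, iteratedDeriv_one, d1, (hq2 0).deriv] at h0 h1 h2
  refine ⟨by simpa using h0, by simpa using h1, ?_⟩
  rw [sub_eq_zero.1 h2]
  ring

end Taylor

/-! ### The iteration for matrices -/

section MatrixIteration

open scoped Matrix.Norms.Operator in
/-- The iteration for matrices.  The operator norm serves only to prove the convergence; the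
conclusion refers to the entrywise topology. -/
lemma matrix_iteration {n : Type*} [Fintype n] [DecidableEq n] (K T : Matrix n n ℂ)
    (I Q : Matrix n n ℂ →ₗ[ℂ] Matrix n n ℂ) (hI : IsHomologicalInverse K I Q) :
    ∃ F : ℂ → Matrix n n ℂ,
      (∀ᶠ ξ : ℂ in 𝓝 0, Tendsto (fun k => (conjStep K I)^[k] (ξ • T)) atTop (𝓝 (F ξ)) ∧
        Q (F ξ) = 0) ∧
      ∀ i j, AnalyticAt ℂ (fun ξ => F ξ i j) 0 ∧
        (fun ξ : ℂ => F ξ i j - (ξ * (T - Q T) i j +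
          ξ ^ 2 * (quadTerm I Q T - Q (quadTerm I Q T)) i j)) =O[𝓝 0] fun ξ => ‖ξ‖ ^ 3 := by
  let I' : Matrix n n ℂ →L[ℂ] Matrix n n ℂ := LinearMap.toContinuousLinearMap I
  let Q' : Matrix n n ℂ →L[ℂ] Matrix n n ℂ := LinearMap.toContinuousLinearMap Q
  have hI' : IsHomologicalInverse K I' Q' := hI
  have htend : Tendsto (fun ξ : ℂ => ξ • T) (𝓝 0) (𝓝 0) := by
    have : Continuous fun ξ : ℂ => ξ • T := by fun_prop
    simpa using this.tendsto 0
  obtain ⟨r, hr, hlim⟩ := exists_iterLimit_bound hI'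
  refine ⟨fun ξ => iterLimit K I' (ξ • T), ?_, fun i j => ?_⟩
  · have hsmall : ∀ᶠ B : Matrix n n ℂ in 𝓝 0, ‖B‖ ≤ r := by
      filter_upwards [Metric.closedBall_mem_nhds (0 : Matrix n n ℂ) hr] with B hB
      simpa using hB
    filter_upwards [htend.eventually hsmall] with ξ hξ
    exact ⟨(hlim _ hξ).1, (hlim _ hξ).2.1⟩
  · let ev : Matrix n n ℂ →L[ℂ] ℂ := LinearMap.toContinuousLinearMap (Matrix.entryLinearMap ℂ ℂ i j)
    refine ⟨(ev.analyticAt _).comp (analyticAt_iterLimit_smul hI' T), ?_⟩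
    exact ((ev.isBigO_comp _ _).trans (iterLimit_smul_isBigO hI' T)).congr_left fun ξ => rfl

end MatrixIteration

/-! ### Energies of the occupation states -/

section Energies

variable {V : Type} [Fintype V] [LinearOrder V]

/-- The sign of a spin component: `1` for spin up, `-1` for spin down. -/
def spinSign : Fin 2 → ℝ := ![1, -1]

lemma spinSign_sq (i : Fin 2) : spinSign i * spinSign i = 1 := by
  fin_cases i <;> simp [spinSign]

lemma spinSign_of_ne {i j : Fin 2} (h : i ≠ j) : spinSign i = -spinSign j := by
  fin_cases i <;> fin_cases j <;> simp_all [spinSign]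

/-- The number of doubly occupied sites of an occupation state. -/
def dblCount (s : Finset (V × Fin 2)) : ℕ :=
  (Finset.univ.filter fun x : V => (x, (0 : Fin 2)) ∈ s ∧ (x, (1 : Fin 2)) ∈ s).card

/-- The staggered magnetisation of an occupation state. -/
def magCount (η : V → ℝ) (s : Finset (V × Fin 2)) : ℝ :=
  ∑ a ∈ s, η a.1 * spinSign a.2 / 2

/-- The unperturbed energy of an occupation state. -/
def energy (η : V → ℝ) (U h : ℝ) (s : Finset (V × Fin 2)) : ℝ :=
  U * dblCount s - h * magCount η s

lemma dblOcc_self (s : HF V) : dblOcc s s = (dblCount s.1 : ℂ) := by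
  rw [dblOcc_eq, Matrix.diagonal_apply_eq, dblCount]

lemma stagMag_self (η : V → ℝ) (s : HF V) : stagMag η s s = (magCount η s.1 : ℂ) := by
  have e : magCount η s.1 = ∑ x : V, ∑ i : Fin 2,
      if (x, i) ∈ s.1 then η x * spinSign i / 2 else 0 := by
    rw [magCount, ← Finset.sum_product', Finset.univ_product_univ, ← Finset.sum_filter]
    simp
  rw [e]
  simp only [stagMag, toHF, Matrix.submatrix_apply, Matrix.sum_apply, num_eq, Matrix.smul_apply,
    Matrix.sub_apply, Matrix.diagonal_apply_eq, smul_eq_mul, Fin.sum_univ_two, spinSign]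
  push_cast
  refine Finset.sum_congr rfl fun x _ => ?_
  by_cases h0 : (x, (0 : Fin 2)) ∈ s.1 <;> by_cases h1 : (x, (1 : Fin 2)) ∈ s.1 <;>
    simp [h0, h1] <;> ring

lemma freeHam_self (η : V → ℝ) (U h : ℝ) (s : HF V) :
    freeHam η U h s s = (energy η U h s.1 : ℂ) := by
  simp [freeHam, dblOcc_self, stagMag_self, energy]

lemma dblCount_insert {x : V} {i : Fin 2} {s : Finset (V × Fin 2)} (hs : (x, i) ∉ s) :
    dblCount (insert (x, i) s) = dblCount s + if (x, i + 1) ∈ s then 1 else 0 := by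
  have key : ∀ z : V, ((z, (0 : Fin 2)) ∈ insert (x, i) s ∧ (z, (1 : Fin 2)) ∈ insert (x, i) s) ↔
      ((z, (0 : Fin 2)) ∈ s ∧ (z, (1 : Fin 2)) ∈ s) ∨ (z = x ∧ (x, i + 1) ∈ s) := by
    intro z
    by_cases hz : z = x
    · subst hz
      fin_cases i <;> simp_all
    · simp [hz]
  have hx : x ∉ Finset.univ.filter fun z : V => (z, (0 : Fin 2)) ∈ s ∧ (z, (1 : Fin 2)) ∈ s := by
    fin_cases i <;> simp_all
  simp only [dblCount, key]
  split_ifs with h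
  · rw [← Finset.card_insert_of_notMem hx]
    congr 1
    ext z
    simp [h, or_comm]
  · simp [h]

lemma magCount_insert (η : V → ℝ) {a : V × Fin 2} {s : Finset (V × Fin 2)} (ha : a ∉ s) :
    magCount η (insert a s) = magCount η s + η a.1 * spinSign a.2 / 2 := by
  rw [magCount, Finset.sum_insert ha, add_comm, magCount]

end Energies

/-! ### The hopping operator -/

section Hopping

variable {V : Type} [Fintype V] [LinearOrder V]

/-- A sum over ordered pairs of neighbours counts each bond twice. -/
lemma sum_adj_eq_two_nsmul {M : Type*} [AddCommMonoid M] (G : SimpleGraph V)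
    [DecidableRel G.Adj] [Fintype G.edgeSet] (f : Sym2 V → M) :
    ∑ x, ∑ y, (if G.Adj x y then f s(x, y) else 0) = 2 • ∑ e ∈ G.edgeFinset, f e := by
  have h1 : ∑ x, ∑ y, (if G.Adj x y then f s(x, y) else 0) = ∑ d : G.Dart, f d.edge := by
    rw [← Finset.sum_product', Finset.univ_product_univ, ← Finset.sum_filter]
    refine (Finset.sum_bij (fun d _ => d.toProd) ?_ ?_ ?_ ?_).symm
    · intro d _
      simp
    · intro d _ d' _ h
      exact SimpleGraph.Dart.ext _ _ h
    · intro p hp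
      exact ⟨⟨p, by simpa using hp⟩, Finset.mem_univ _, rfl⟩
    · intro d _
      rfl
  rw [h1, ← Finset.sum_fiberwise_of_maps_to (s := Finset.univ) (t := G.edgeFinset)
    (g := fun d : G.Dart => d.edge) (fun d _ => by simp [SimpleGraph.Dart.edge_mem]),
    Finset.smul_sum]
  refine Finset.sum_congr rfl fun e he => ?_
  rw [Finset.sum_congr rfl (g := fun _ => f e) (fun d hd => by rw [(Finset.mem_filter.1 hd).2]),
    Finset.sum_const, G.dart_edge_fiber_card e (by simpa using he)]

open scoped Classical in
/-- The hopping operator with unit amplitude as a sum over ordered pairs of neighbours. -/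
def hopSum (G : SimpleGraph V) : Matrix (Finset (V × Fin 2)) (Finset (V × Fin 2)) ℂ :=
  ∑ x, ∑ y, if G.Adj x y then ∑ i : Fin 2, cdag (x, i) * cann (y, i) else 0

lemma hopping_apply (G : SimpleGraph V) (t : ℝ) (s s' : HF V) :
    hopping G t s s' = -t * hopSum G s.1 s'.1 := by
  classical
  have hswap : hopSum G =
      ∑ x, ∑ y, if G.Adj x y then ∑ i : Fin 2, cdag (y, i) * cann (x, i) else 0 := by
    rw [hopSum, Finset.sum_comm]
    refine Finset.sum_congr rfl fun x _ => Finset.sum_congr rfl fun y _ => ?_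
    rw [G.adj_comm]
  have h : (2 : ℕ) • ∑ e ∈ G.edgeFinset, bondHop e = (2 : ℕ) • hopSum G := by
    rw [← sum_adj_eq_two_nsmul, two_nsmul]
    nth_rw 2 [hswap]
    rw [hopSum, ← Finset.sum_add_distrib]
    refine Finset.sum_congr rfl fun x _ => ?_
    rw [← Finset.sum_add_distrib]
    refine Finset.sum_congr rfl fun y _ => ?_
    by_cases hxy : G.Adj x y
    · simp only [hxy, if_true, bondHop, Sym2.lift_mk, Finset.sum_add_distrib]
    · simp [hxy]
  rw [← Nat.cast_smul_eq_nsmul ℂ, ← Nat.cast_smul_eq_nsmul ℂ] at h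
  have h' := smul_right_injective _ (by norm_num : ((2 : ℕ) : ℂ) ≠ 0) h
  simp only [hopping, toHF, Matrix.submatrix_apply, Matrix.smul_apply, smul_eq_mul]
  rw [← h']

lemma hopSum_apply (G : SimpleGraph V) [DecidableRel G.Adj] (s s' : Finset (V × Fin 2)) :
    hopSum G s s' = ∑ x, ∑ y, if G.Adj x y then
      ∑ i : Fin 2, (cdag (x, i) * cann (y, i)) s s' else 0 := by
  simp only [hopSum, Matrix.sum_apply]
  refine Finset.sum_congr rfl fun x _ => Finset.sum_congr rfl fun y _ => ?_
  by_cases hxy : G.Adj x y <;> simp [hxy, Matrix.sum_apply]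

lemma hopSum_symm (G : SimpleGraph V) (s s' : Finset (V × Fin 2)) :
    hopSum G s s' = hopSum G s' s := by
  classical
  have h : ∀ (a b : V × Fin 2), (cdag a * cann b) s s' = (cdag b * cann a) s' s := by
    intro a b
    simp only [Matrix.mul_apply, cann_apply]
    exact Finset.sum_congr rfl fun u _ => mul_comm _ _
  rw [hopSum_apply, hopSum_apply, Finset.sum_comm]
  refine Finset.sum_congr rfl fun x _ => Finset.sum_congr rfl fun y _ => ?_
  simp only [h, G.adj_comm y x]

lemma cdag_mul_cann_apply (a b : V × Fin 2) (s s' : Finset (V × Fin 2)) :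
    (cdag a * cann b) s s' =
      if b ∈ s' ∧ a ∉ s'.erase b ∧ s = insert a (s'.erase b) then
        sgn a (s'.erase b) * sgn b (s'.erase b) else 0 := by
  rw [mul_cann_apply, cdag_apply]
  split_ifs <;> simp_all

/-- A hop along a bond of a bipartite graph that changes the number of doubly occupied sites
changes it by one, and it changes the staggered magnetisation by one. Hence the hopping operator
does not connect resonant states if `|h| < U`. -/
lemma energy_ne_of_hopSum_ne_zero (G : SimpleGraph V) {η : V → ℝ} {U h : ℝ}
    (hη : ∀ x y, G.Adj x y → η y = -η x) (hη1 : ∀ x, η x * η x = 1) (hU : |h| < U)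
    {s s' : Finset (V × Fin 2)} (hs : hopSum G s s' ≠ 0) (hd : dblCount s ≠ dblCount s') :
    energy η U h s ≠ energy η U h s' := by
  classical
  rw [hopSum_apply] at hs
  obtain ⟨x, _, hs⟩ := Finset.exists_ne_zero_of_sum_ne_zero hs
  obtain ⟨y, _, hs⟩ := Finset.exists_ne_zero_of_sum_ne_zero hs
  have hxy : G.Adj x y := by
    by_contra hxy
    simp [hxy] at hs
  rw [if_pos hxy] at hs
  obtain ⟨i, _, hs⟩ := Finset.exists_ne_zero_of_sum_ne_zero hs
  rw [cdag_mul_cann_apply] at hs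
  obtain ⟨h1, h2, h3⟩ : (y, i) ∈ s' ∧ (x, i) ∉ s'.erase (y, i) ∧
      s = insert (x, i) (s'.erase (y, i)) := by
    by_contra hc
    exact hs (if_neg hc)
  set r := s'.erase (y, i) with hr
  have h4 : (y, i) ∉ r := Finset.notMem_erase _ _
  have h5 : s' = insert (y, i) r := (Finset.insert_erase h1).symm
  rw [h3, h5, dblCount_insert h2, dblCount_insert h4] at hd
  rw [h3, h5, energy, energy, dblCount_insert h2, dblCount_insert h4, magCount_insert η h2,
    magCount_insert η h4, hη x y hxy]
  obtain ⟨b1, b2⟩ := abs_lt.1 hU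
  set a := η x * spinSign i with ha
  have ha1 : a * a = 1 := by
    rw [ha, mul_mul_mul_comm, hη1, spinSign_sq, one_mul]
  have ha' : a = 1 ∨ a = -1 := mul_self_eq_one_iff.1 ha1
  intro heq
  have heq' : U * ((if (x, i + 1) ∈ r then 1 else 0) - (if (y, i + 1) ∈ r then 1 else 0)) =
      h * a := by
    push_cast at heq
    rw [ha]
    linarith
  split_ifs at heq' hd with c1 c2 c2
  · exact hd rfl
  all_goals first | exact hd rfl | (rcases ha' with e | e <;> rw [e] at heq' <;> linarith)

end Hopping

/-! ### Singly occupied states and the spin identification -/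

section SinglyOccupied

variable {V : Type} [Fintype V] [LinearOrder V]

/-- The singly occupied state with spins `τ`: at each site `x` the mode `(x, τ x)` is occupied. -/
def occ (τ : V → Fin 2) : Finset (V × Fin 2) :=
  Finset.univ.filter fun a => τ a.1 = a.2

lemma mem_occ {τ : V → Fin 2} {a : V × Fin 2} : a ∈ occ τ ↔ τ a.1 = a.2 := by
  simp [occ]

lemma card_occ (τ : V → Fin 2) : (occ τ).card = Fintype.card V := by
  refine (Finset.card_bij (s := Finset.univ) (fun x _ => (x, τ x)) ?_ ?_ ?_).symm
  · intro x _; simp [mem_occ]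
  · intro x _ y _ h; exact congrArg Prod.fst h
  · rintro ⟨x, i⟩ h
    exact ⟨x, Finset.mem_univ _, Prod.ext rfl (mem_occ.1 h)⟩

lemma occ_injective : Function.Injective (occ : (V → Fin 2) → Finset (V × Fin 2)) := by
  intro σ τ h
  funext x
  have : (x, σ x) ∈ occ τ := h ▸ mem_occ.2 rfl
  exact (mem_occ.1 this).symm

/-- The singly occupied state with spins `τ` as an element of the half-filled sector. -/
def occHF (τ : V → Fin 2) : HF V := ⟨occ τ, card_occ τ⟩

lemma dblCount_occ (τ : V → Fin 2) : dblCount (occ τ) = 0 := by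
  rw [dblCount, Finset.card_eq_zero, Finset.filter_eq_empty_iff]
  rintro x - ⟨h0, h1⟩
  rw [mem_occ] at h0 h1
  exact absurd (h0.symm.trans h1) (by simp)

lemma magCount_occ (η : V → ℝ) (τ : V → Fin 2) :
    magCount η (occ τ) = ∑ x, η x * spinSign (τ x) / 2 := by
  refine (Finset.sum_bij (fun x _ => (x, τ x)) ?_ ?_ ?_ ?_).symm
  · intro x _; simp [mem_occ]
  · intro x _ y _ h; exact congrArg Prod.fst h
  · rintro ⟨x, i⟩ h
    exact ⟨x, Finset.mem_univ _, Prod.ext rfl (mem_occ.1 h)⟩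
  · intro x _; rfl

/-- At half filling a state without doubly occupied sites has no empty sites either. -/
lemma exists_eq_occHF {s : HF V} (hs : dblCount s.1 = 0) : ∃ τ, s = occHF τ := by
  have hinj : Set.InjOn Prod.fst (s.1 : Set (V × Fin 2)) := by
    rintro ⟨x, i⟩ hx ⟨y, j⟩ hy (rfl : x = y)
    rw [dblCount, Finset.card_eq_zero, Finset.filter_eq_empty_iff] at hs
    have := hs (Finset.mem_univ x)
    simp only [Finset.mem_coe] at hx hy
    fin_cases i <;> fin_cases j <;> simp_all
  have himg : s.1.image Prod.fst = Finset.univ := by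
    rw [← Finset.card_eq_iff_eq_univ, Finset.card_image_of_injOn hinj, s.2]
  have hex : ∀ x : V, ∃ i, (x, i) ∈ s.1 := by
    intro x
    have hx : x ∈ s.1.image Prod.fst := himg ▸ Finset.mem_univ x
    obtain ⟨⟨y, i⟩, hy, rfl⟩ := Finset.mem_image.1 hx
    exact ⟨i, hy⟩
  choose τ hτ using hex
  refine ⟨τ, Subtype.ext (Finset.eq_of_subset_of_card_le ?_ ?_).symm⟩
  · rintro ⟨x, i⟩ h
    obtain rfl : τ x = i := mem_occ.1 h
    exact hτ x
  · rw [s.2]; exact (card_occ τ).ge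

lemma cdag_mulVec_single (a : V × Fin 2) {s : Finset (V × Fin 2)} (ha : a ∉ s) :
    cdag a *ᵥ Pi.single s 1 = sgn a s • Pi.single (insert a s) (1 : ℂ) := by
  ext u
  rw [Matrix.mulVec_single_one]
  simp [Matrix.col_apply, cdag_apply, ha, Pi.single_apply]

/-- The product of creation operators in increasing order of the sites produces no sign. -/
lemma spinState_eq (τ : V → Fin 2) : spinState τ = Pi.single (occ τ) 1 := by
  have key : ∀ l : List V, l.Pairwise (· < ·) →
      (l.map fun x => cdag (x, τ x)).prod *ᵥ vacuum =
        Pi.single ((occ τ).filter fun a => a.1 ∈ l) 1 := by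
    intro l
    induction l with
    | nil =>
      intro _
      rw [List.map_nil, List.prod_nil, Matrix.one_mulVec]
      simp [vacuum]
    | cons x l ih =>
      intro hl
      rw [List.pairwise_cons] at hl
      have hx : (x, τ x) ∉ (occ τ).filter fun a => a.1 ∈ l := by
        intro h
        exact lt_irrefl x (hl.1 x (Finset.mem_filter.1 h).2)
      rw [List.map_cons, List.prod_cons, ← Matrix.mulVec_mulVec, ih hl.2,
        cdag_mulVec_single _ hx]
      have hsgn : sgn (x, τ x) ((occ τ).filter fun a => a.1 ∈ l) = 1 := by
        rw [sgn, Finset.filter_eq_empty_iff.2, Finset.card_empty, pow_zero]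
        intro b hb
        rw [not_lt]
        exact (Prod.Lex.toLex_lt_toLex.2 (Or.inl (hl.1 _ (Finset.mem_filter.1 hb).2))).le
      rw [hsgn, one_smul]
      congr 1
      ext ⟨y, i⟩
      simp only [Finset.mem_insert, Finset.mem_filter, mem_occ, List.mem_cons, Prod.mk.injEq]
      constructor
      · rintro (⟨rfl, rfl⟩ | ⟨h1, h2⟩)
        · exact ⟨rfl, Or.inl rfl⟩
        · exact ⟨h1, Or.inr h2⟩
      · rintro ⟨h1, rfl | h2⟩
        · exact Or.inl ⟨rfl, h1.symm⟩
        · exact Or.inr ⟨h1, h2⟩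
  rw [spinState, key _ (Finset.sortedLT_sort _).pairwise]
  congr 1
  simp

lemma spinIdent_apply (σ : V → Fin 2) (s : HF V) :
    spinIdent σ s = if s = occHF σ then 1 else 0 := by
  simp only [spinIdent, Matrix.of_apply, spinState_eq, Pi.single_apply, Subtype.ext_iff, occHF]
  split_ifs <;> simp

lemma spinIdent_conj_apply (A : Matrix (HF V) (HF V) ℂ) (σ τ : V → Fin 2) :
    (spinIdent (V := V) * A * (spinIdent (V := V))ᴴ) σ τ = A (occHF σ) (occHF τ) := by
  simp only [Matrix.mul_apply, Matrix.conjTranspose_apply, spinIdent_apply]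
  simp

lemma spinIdent_mul_conjTranspose :
    (spinIdent (V := V)) * (spinIdent (V := V))ᴴ = 1 := by
  ext σ τ
  have h := spinIdent_conj_apply (1 : Matrix (HF V) (HF V) ℂ) σ τ
  rw [Matrix.mul_one] at h
  rw [h, Matrix.one_apply, Matrix.one_apply]
  simp [occHF, occ_injective.eq_iff]

lemma specProj_zero_apply (s s' : HF V) :
    specProj 0 s s' = if s = s' ∧ dblCount s.1 = 0 then 1 else 0 := by
  rw [specProj, Matrix.diagonal_apply, dblOcc_self]
  by_cases hs : s = s' <;> simp [hs]

/-- The enumeration of the spin configurations is arbitrary: on the torus there are two ways to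
decide equality of sites, which lead to two instances. -/
lemma spinIdent_conjTranspose_mul [Fintype (V → Fin 2)] :
    (spinIdent (V := V))ᴴ * (spinIdent (V := V)) = specProj 0 := by
  ext s s'
  rw [specProj_zero_apply]
  simp only [Matrix.mul_apply, Matrix.conjTranspose_apply, spinIdent_apply]
  by_cases hs : dblCount s.1 = 0
  · obtain ⟨τ, rfl⟩ := exists_eq_occHF hs
    rw [Finset.sum_eq_single τ]
    · simp [hs, eq_comm]
    · intro σ _ hσ
      have : occHF τ ≠ occHF σ := fun h => hσ (occ_injective (congrArg Subtype.val h)).symm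
      simp [this]
    · simp
  · rw [if_neg (fun h => hs h.2)]
    refine Finset.sum_eq_zero fun σ _ => ?_
    have : s ≠ occHF σ := fun h => hs (by rw [h]; exact dblCount_occ σ)
    simp [this]

lemma specProj_zero_conj_apply (A : Matrix (HF V) (HF V) ℂ) (σ τ : V → Fin 2) :
    (specProj 0 * A * specProj 0 : Matrix (HF V) (HF V) ℂ) (occHF σ) (occHF τ) =
      A (occHF σ) (occHF τ) := by
  have h : ∀ σ : V → Fin 2, dblOcc (occHF σ) (occHF σ) = (0 : ℂ) := fun σ => by
    rw [dblOcc_self]; simp [occHF, dblCount_occ]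
  simp [specProj, h]

end SinglyOccupied

/-! ### Virtual hops out of the singly occupied sector -/

section VirtualHopping

variable {V : Type} [Fintype V] [LinearOrder V]

/-- The state reached from the singly occupied state with spins `τ` when the particle at `y` hops
to `x`. -/
def hopSet (τ : V → Fin 2) (x y : V) : Finset (V × Fin 2) :=
  insert (x, τ y) ((occ τ).erase (y, τ y))

/-- The fermionic sign of the hop from `y` to `x`. -/
def hopSgn (τ : V → Fin 2) (x y : V) : ℂ :=
  sgn (x, τ y) ((occ τ).erase (y, τ y)) * sgn (y, τ y) ((occ τ).erase (y, τ y))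

lemma notMem_erase_occ {τ : V → Fin 2} {x y : V} (h : τ x ≠ τ y) :
    (x, τ y) ∉ (occ τ).erase (y, τ y) := by
  simp [mem_occ, h]

lemma mem_hopSet {τ : V → Fin 2} {x y z : V} (h : τ x ≠ τ y) (i : Fin 2) :
    (z, i) ∈ hopSet τ x y ↔ z = x ∨ (z ≠ y ∧ τ z = i) := by
  simp only [hopSet, Finset.mem_insert, Finset.mem_erase, mem_occ, Prod.mk.injEq, ne_eq]
  constructor
  · rintro (⟨rfl, -⟩ | ⟨h1, h2⟩)
    · exact Or.inl rfl
    · refine Or.inr ⟨fun hz => h1 ⟨hz, ?_⟩, h2⟩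
      rw [← h2, hz]
  · rintro (rfl | ⟨h1, h2⟩)
    · by_cases hi : i = τ y
      · exact Or.inl ⟨rfl, hi⟩
      · refine Or.inr ⟨fun hc => hi hc.2, ?_⟩
        omega
    · exact Or.inr ⟨fun hc => h1 hc.1, h2⟩

lemma card_hopSet {τ : V → Fin 2} {x y : V} (h : τ x ≠ τ y) :
    (hopSet τ x y).card = Fintype.card V := by
  rw [hopSet, Finset.card_insert_of_notMem (notMem_erase_occ h),
    Finset.card_erase_add_one (mem_occ.2 rfl), card_occ]

lemma dblCount_hopSet {τ : V → Fin 2} {x y : V} (h : τ x ≠ τ y) :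
    dblCount (hopSet τ x y) = 1 := by
  have e : dblCount (occ τ) = _ := congrArg dblCount
    (Finset.insert_erase (mem_occ.2 rfl : (y, τ y) ∈ occ τ)).symm
  rw [dblCount_insert (Finset.notMem_erase _ _), dblCount_occ] at e
  have hx : (x, τ y + 1) ∈ (occ τ).erase (y, τ y) := by
    have : τ x = τ y + 1 := by omega
    simp [mem_occ, this]
  rw [hopSet, dblCount_insert (notMem_erase_occ h), if_pos hx]
  omega

lemma energy_hopSet (η : V → ℝ) (U h : ℝ) {τ : V → Fin 2} {x y : V} (hτ : τ x ≠ τ y)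
    (hη : η y = -η x) :
    energy η U h (hopSet τ x y) = energy η U h (occ τ) + (U - h * (η x * spinSign (τ y))) := by
  have e : magCount η (occ τ) = _ := congrArg (magCount η)
    (Finset.insert_erase (mem_occ.2 rfl : (y, τ y) ∈ occ τ)).symm
  rw [magCount_insert η (Finset.notMem_erase _ _)] at e
  rw [energy, energy, dblCount_hopSet hτ, dblCount_occ, e, hopSet,
    magCount_insert η (notMem_erase_occ hτ)]
  simp only [hη]
  push_cast
  ring

/-- Exchange of the spins at `x` and `y`. -/
abbrev swapSpin (τ : V → Fin 2) (x y : V) : V → Fin 2 := τ ∘ Equiv.swap x y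

/-- The intermediate state determines the bond of the hop, and it determines the initial spins up
to an exchange on this bond. -/
lemma hopSet_eq_hopSet {σ τ : V → Fin 2} {x y x' y' : V} (hτ : τ x ≠ τ y) (hσ : σ x' ≠ σ y')
    (he : hopSet τ x y = hopSet σ x' y') :
    x = x' ∧ y = y' ∧ (σ = τ ∨ σ = swapSpin τ x y) := by
  have hm : ∀ z i, (z = x ∨ (z ≠ y ∧ τ z = i)) ↔ (z = x' ∨ (z ≠ y' ∧ σ z = i)) := fun z i => by
    rw [← mem_hopSet hτ, ← mem_hopSet hσ, he]
  have hx : x = x' := by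
    by_contra hne
    have h1 := (hm x (σ x + 1)).1 (Or.inl rfl)
    rcases h1 with h1 | h1
    · exact hne h1
    · omega
  subst hx
  have hxy : x ≠ y := fun h => hτ (by rw [h])
  have hxy' : x ≠ y' := fun h => hσ (by rw [h])
  have hy : y = y' := by
    by_contra hne
    rcases (hm y (σ y)).2 (Or.inr ⟨hne, rfl⟩) with h1 | h1
    · exact hxy h1.symm
    · exact h1.1 rfl
  subst hy
  have hz : ∀ z, z ≠ x → z ≠ y → σ z = τ z := by
    intro z h1 h2
    rcases (hm z (τ z)).1 (Or.inr ⟨h2, rfl⟩) with h3 | h3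
    · exact absurd h3 h1
    · exact h3.2
  refine ⟨rfl, rfl, ?_⟩
  by_cases hc : σ x = τ x
  · left
    funext z
    by_cases h1 : z = x
    · rw [h1, hc]
    by_cases h2 : z = y
    · rw [h2]; omega
    exact hz z h1 h2
  · right
    funext z
    by_cases h1 : z = x
    · rw [h1, swapSpin, Function.comp, Equiv.swap_apply_left]; omega
    by_cases h2 : z = y
    · rw [h2, swapSpin, Function.comp, Equiv.swap_apply_right]; omega
    rw [swapSpin, Function.comp, Equiv.swap_apply_of_ne_of_ne h1 h2, hz z h1 h2]

lemma hopSgn_mul_self (τ : V → Fin 2) (x y : V) : hopSgn τ x y * hopSgn τ x y = 1 := by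
  rw [hopSgn, mul_mul_mul_comm, sgn_mul_self, sgn_mul_self, one_mul]

lemma swapSpin_left (τ : V → Fin 2) (x y : V) : swapSpin τ x y x = τ y := by simp

lemma swapSpin_right (τ : V → Fin 2) (x y : V) : swapSpin τ x y y = τ x := by simp

lemma hopSet_swapSpin {τ : V → Fin 2} {x y : V} (hτ : τ x ≠ τ y) :
    hopSet (swapSpin τ x y) x y = hopSet τ x y := by
  ext ⟨z, i⟩
  rw [mem_hopSet hτ, mem_hopSet (by rw [swapSpin_left, swapSpin_right]; exact hτ.symm)]
  by_cases h1 : z = x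
  · simp [h1]
  by_cases h2 : z = y
  · simp [h2]
  simp [h1, h2, Equiv.swap_apply_of_ne_of_ne h1 h2]

/-- The sign of a creation operator does not depend on the spin if the site is empty. -/
lemma sgn_eq_of_forall_notMem {x : V} {s : Finset (V × Fin 2)} (hs : ∀ i, (x, i) ∉ s)
    (i j : Fin 2) : sgn (x, i) s = sgn (x, j) s := by
  unfold sgn
  congr 2
  refine Finset.filter_congr ?_
  rintro ⟨z, k⟩ hz
  have hzx : z ≠ x := fun h => hs k (h ▸ hz)
  simp [Prod.Lex.toLex_lt_toLex, hzx]

/-- The two ways to return from the intermediate state differ by a transposition of two fermions,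
hence by a sign. -/
lemma hopSgn_swapSpin {τ : V → Fin 2} {x y : V} (hτ : τ x ≠ τ y) :
    hopSgn (swapSpin τ x y) x y = -hopSgn τ x y := by
  have hxy : x ≠ y := fun h => hτ (by rw [h])
  set r := (occ τ).filter fun a => a.1 ≠ x ∧ a.1 ≠ y with hr
  have hrx : ∀ i, (x, i) ∉ r := fun i => by simp [hr]
  have hry : ∀ i, (y, i) ∉ r := fun i => by simp [hr]
  have e1 : (occ τ).erase (y, τ y) = insert (x, τ x) r := by
    ext ⟨z, i⟩
    simp only [Finset.mem_erase, Finset.mem_insert, mem_occ, Finset.mem_filter, Prod.mk.injEq, hr]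
    grind
  have e2 : (occ (swapSpin τ x y)).erase (y, τ x) = insert (x, τ y) r := by
    ext ⟨z, i⟩
    simp only [Finset.mem_erase, Finset.mem_insert, mem_occ, Finset.mem_filter, Prod.mk.injEq, hr,
      Function.comp, Equiv.swap_apply_def]
    grind
  rw [hopSgn, hopSgn, swapSpin_right, e1, e2, sgn_insert _ _ _ (hrx _), sgn_insert _ _ _ (hrx _),
    sgn_insert _ _ _ (hrx _), sgn_insert _ _ _ (hrx _), sgn_eq_of_forall_notMem hrx (τ x) (τ y),
    sgn_eq_of_forall_notMem hry (τ x) (τ y)]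
  simp only [Prod.Lex.toLex_lt_toLex, lt_irrefl, false_or, true_and, hxy, false_and, or_false]
  rcases lt_or_gt_of_ne hτ with h | h
  · simp only [h, h.not_gt, if_true, if_false]; ring
  · simp only [h, h.not_gt, if_true, if_false]; ring

lemma hopSum_occ (G : SimpleGraph V) [DecidableRel G.Adj] (s : Finset (V × Fin 2))
    (τ : V → Fin 2) :
    hopSum G s (occ τ) = ∑ x, ∑ y, if G.Adj x y ∧ τ x ≠ τ y then
      (if s = hopSet τ x y then hopSgn τ x y else 0) else 0 := by
  rw [hopSum_apply]
  refine Finset.sum_congr rfl fun x _ => Finset.sum_congr rfl fun y _ => ?_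
  by_cases hxy : G.Adj x y
  · rw [if_pos hxy, Finset.sum_eq_single (τ y)]
    · have hne : x ≠ y := hxy.ne
      rw [cdag_mul_cann_apply]
      simp only [mem_occ, true_and, hxy, Finset.mem_erase, ne_eq, Prod.mk.injEq, hne, false_and,
        not_false_eq_true, hopSgn, hopSet]
      split_ifs <;> simp_all
    · intro i _ hi
      rw [cdag_mul_cann_apply, if_neg]
      exact fun h => hi (mem_occ.1 h.1).symm
    · simp
  · simp [hxy]

/-- The amplitudes to return from the intermediate state of a hop. -/
lemma hopSum_hopSet (G : SimpleGraph V) (σ : V → Fin 2) {τ : V → Fin 2} {x y : V}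
    (hxy : G.Adj x y) (hτ : τ x ≠ τ y) :
    hopSum G (hopSet τ x y) (occ σ) * hopSgn τ x y =
      (if σ = τ then 1 else 0) - if σ = swapSpin τ x y then 1 else 0 := by
  classical
  have hne : τ ≠ swapSpin τ x y := fun h => hτ (by
    have := congrFun h x
    rwa [swapSpin_left] at this)
  rw [hopSum_occ, Finset.sum_eq_single x, Finset.sum_eq_single y]
  · by_cases h1 : σ = τ
    · subst h1
      simp [hxy, hτ, hne, hopSgn_mul_self]
    by_cases h2 : σ = swapSpin τ x y
    · have h3 : hopSet τ x y = hopSet σ x y := by rw [h2, hopSet_swapSpin hτ]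
      have h4 : σ x ≠ σ y := by
        rw [h2, swapSpin_left, swapSpin_right]; exact hτ.symm
      rw [if_pos ⟨hxy, h4⟩, if_pos h3, if_neg h1, if_pos h2, h2, hopSgn_swapSpin hτ, neg_mul,
        hopSgn_mul_self, zero_sub]
    · rw [if_neg h1, if_neg h2, sub_zero]
      split_ifs with h3 h4
      · rcases (hopSet_eq_hopSet hτ h3.2 h4).2.2 with h5 | h5
        · exact absurd h5 h1
        · exact absurd h5 h2
      · rw [zero_mul]
      · rw [zero_mul]
  · intro y' _ hy'
    split_ifs with h3 h4
    · exact absurd (hopSet_eq_hopSet hτ h3.2 h4).2.1.symm hy'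
    · rfl
    · rfl
  · simp
  · intro x' _ hx'
    refine Finset.sum_eq_zero fun y' _ => ?_
    split_ifs with h3 h4
    · exact absurd (hopSet_eq_hopSet hτ h3.2 h4).1.symm hx'
    · rfl
    · rfl
  · simp

/-- Sum over the intermediate states of second order perturbation theory, with a weight `w`. -/
lemma sum_hopSum_mul_hopSum (G : SimpleGraph V) [DecidableRel G.Adj] (σ τ : V → Fin 2)
    (w : Finset (V × Fin 2) → ℂ) :
    ∑ u : HF V, hopSum G u.1 (occ σ) * hopSum G u.1 (occ τ) * w u.1 =
      ∑ x, ∑ y, if G.Adj x y ∧ τ x ≠ τ y then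
        ((if σ = τ then 1 else 0) - if σ = swapSpin τ x y then 1 else 0) * w (hopSet τ x y)
      else 0 := by
  simp_rw [hopSum_occ G _ τ, Finset.mul_sum, Finset.sum_mul]
  rw [Finset.sum_comm]
  refine Finset.sum_congr rfl fun x _ => ?_
  rw [Finset.sum_comm]
  refine Finset.sum_congr rfl fun y _ => ?_
  by_cases h : G.Adj x y ∧ τ x ≠ τ y
  · simp only [if_pos h]
    rw [Finset.sum_eq_single ⟨hopSet τ x y, card_hopSet h.2⟩]
    · rw [if_pos rfl, hopSum_hopSet G σ h.1 h.2]
    · intro u _ hu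
      rw [if_neg fun h => hu (Subtype.ext h)]
      simp
    · simp
  · simp only [if_neg h, mul_zero, zero_mul, Finset.sum_const_zero]

end VirtualHopping

/-! ### The correction and its second order term -/

section SecondOrder

variable {V : Type} [Fintype V] [LinearOrder V]

/-- The homological inverse as a linear map. -/
def invAdLin (η : V → ℝ) (U h : ℝ) : Matrix (HF V) (HF V) ℂ →ₗ[ℂ] Matrix (HF V) (HF V) ℂ where
  toFun := invAd η U h
  map_add' A B := by
    ext s s'
    simp only [invAd, Matrix.of_apply, Matrix.add_apply]
    split_ifs <;> ring
  map_smul' c A := by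
    ext s s'
    simp only [invAd, Matrix.of_apply, Matrix.smul_apply, smul_eq_mul, RingHom.id_apply]
    split_ifs <;> ring

/-- The projection to the matrix entries that change both the double occupancy and the unperturbed
energy. -/
def nonresPart (η : V → ℝ) (U h : ℝ) :
    Matrix (HF V) (HF V) ℂ →ₗ[ℂ] Matrix (HF V) (HF V) ℂ where
  toFun B := Matrix.of fun s s' =>
    if dblOcc s s = dblOcc s' s' ∨ freeHam η U h s s = freeHam η U h s' s' then 0 else B s s'
  map_add' A B := by
    ext s s'
    simp only [Matrix.of_apply, Matrix.add_apply]
    split_ifs <;> ring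
  map_smul' c A := by
    ext s s'
    simp only [Matrix.of_apply, Matrix.smul_apply, smul_eq_mul, RingHom.id_apply]
    split_ifs <;> ring

lemma nonresPart_apply (η : V → ℝ) (U h : ℝ) (B : Matrix (HF V) (HF V) ℂ) (s s' : HF V) :
    nonresPart η U h B s s' =
      if dblOcc s s = dblOcc s' s' ∨ freeHam η U h s s = freeHam η U h s' s' then 0
      else B s s' := rfl

lemma invAdLin_apply (η : V → ℝ) (U h : ℝ) (B : Matrix (HF V) (HF V) ℂ) (s s' : HF V) :
    invAdLin η U h B s s' = if dblOcc s s = dblOcc s' s' then 0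
      else B s s' / (freeHam η U h s s - freeHam η U h s' s') := rfl

/-- The resonant entries, where the energy difference vanishes, are divided by zero in `invAd`, so
they vanish in its image and the inverse property holds for the nonresonant part. -/
lemma isHomologicalInverse_invAdLin (η : V → ℝ) (U h : ℝ) :
    IsHomologicalInverse (freeHam η U h) (invAdLin η U h) (nonresPart η U h) where
  commutator B := by
    ext s s'
    rw [Matrix.sub_apply, isDiag_mul_apply (freeHam_isDiag η U h),
      mul_isDiag_apply (freeHam_isDiag η U h), invAdLin_apply, nonresPart_apply]
    by_cases hd : dblOcc s s = dblOcc s' s'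
    · simp [hd]
    by_cases he : freeHam η U h s s = freeHam η U h s' s'
    · simp [he]
    · have := sub_ne_zero.2 he
      simp only [hd, he, if_false, or_self]
      field_simp
  idem B := by
    ext s s'
    simp only [nonresPart_apply]
    split_ifs <;> rfl
  apply_proj B := by
    ext s s'
    simp only [nonresPart_apply, invAdLin_apply]
    by_cases he : freeHam η U h s s = freeHam η U h s' s'
    · simp [he]
    · simp only [he, or_false]
      split_ifs <;> rfl

lemma lsIter_eq_iterate (G : SimpleGraph V) (η : V → ℝ) (U t h ξ : ℝ) (n : ℕ) :
    lsIter G η U t h ξ n =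
      (conjStep (freeHam η U h) (invAdLin η U h))^[n] ((ξ : ℂ) • hopping G t) := by
  induction n with
  | zero => rfl
  | succ n ih => rw [Function.iterate_succ_apply', ← ih]; rfl

lemma dblOcc_eq_iff (s s' : HF V) : dblOcc s s = dblOcc s' s' ↔ dblCount s.1 = dblCount s'.1 := by
  rw [dblOcc_self, dblOcc_self, Nat.cast_inj]

lemma nonresPart_hopping_apply (G : SimpleGraph V) {η : V → ℝ} {U h : ℝ} (t : ℝ)
    (hη : ∀ x y, G.Adj x y → η y = -η x) (hη1 : ∀ x, η x * η x = 1) (hU : |h| < U)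
    (s s' : HF V) :
    nonresPart η U h (hopping G t) s s' =
      if dblOcc s s = dblOcc s' s' then 0 else hopping G t s s' := by
  rw [nonresPart_apply]
  by_cases hd : dblOcc s s = dblOcc s' s'
  · simp [hd]
  by_cases he : freeHam η U h s s = freeHam η U h s' s'
  · rw [if_pos (Or.inr he), if_neg hd, hopping_apply]
    by_contra h0
    refine energy_ne_of_hopSum_ne_zero G hη hη1 hU (s := s.1) (s' := s'.1)
      (fun h => h0 (by rw [h, mul_zero])) (fun h => hd ((dblOcc_eq_iff s s').2 h)) ?_
    rw [freeHam_self, freeHam_self] at he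
    exact_mod_cast he
  · simp [hd, he]

/-- The second order coefficient of the correction. -/
def quadCoeff (G : SimpleGraph V) (η : V → ℝ) (U t h : ℝ) : Matrix (HF V) (HF V) ℂ :=
  quadTerm (invAdLin η U h) (nonresPart η U h) (hopping G t) -
    nonresPart η U h (quadTerm (invAdLin η U h) (nonresPart η U h) (hopping G t))

/-- Convergence of the iteration, with or without resonances: its limit has no nonresonant
part. -/
lemma eventually_tendsto_lsLimit (G : SimpleGraph V) (η : V → ℝ) (U t h : ℝ) :
    ∀ᶠ ξ : ℝ in 𝓝 0, Tendsto (lsIter G η U t h ξ) atTop (𝓝 (lsLimit G η U t h ξ)) ∧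
      nonresPart η U h (lsLimit G η U t h ξ) = 0 := by
  obtain ⟨F, hF, -⟩ := matrix_iteration _ (hopping G t) _ _ (isHomologicalInverse_invAdLin η U h)
  have hre : Tendsto (fun ξ : ℝ => (ξ : ℂ)) (𝓝 0) (𝓝 0) := by
    simpa using Complex.continuous_ofReal.tendsto 0
  filter_upwards [hre.eventually hF] with ξ hξ
  have h1 : Tendsto (lsIter G η U t h ξ) atTop (𝓝 (F ξ)) :=
    hξ.1.congr fun n => (lsIter_eq_iterate G η U t h ξ n).symm
  have h2 : lsLimit G η U t h ξ = F ξ := h1.limUnder_eq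
  rw [h2]
  exact ⟨h1, hξ.2⟩

/-- Without resonances the correction is diagonal with respect to the double occupancy. -/
lemma eventually_commute_lsCorrection (G : SimpleGraph V) (η : V → ℝ) (U t h : ℝ)
    (hres : ∀ s s' : HF V, dblOcc s s ≠ dblOcc s' s' →
      freeHam η U h s s ≠ freeHam η U h s' s') :
    ∀ᶠ ξ : ℝ in 𝓝 0, Commute (lsCorrection G η U t h ξ) dblOcc := by
  filter_upwards [eventually_tendsto_lsLimit G η U t h] with ξ hξ
  ext s s'
  rw [mul_isDiag_apply dblOcc_isDiag, isDiag_mul_apply dblOcc_isDiag]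
  by_cases hd : dblOcc s s = dblOcc s' s'
  · rw [hd, mul_comm]
  · have h1 : lsLimit G η U t h ξ s s' = 0 := by
      have := congrFun (congrFun hξ.2 s) s'
      rwa [nonresPart_apply, if_neg (not_or.2 ⟨hd, hres s s' hd⟩)] at this
    have h2 : lsCorrection G η U t h ξ s s' = 0 := by
      rw [lsCorrection, Matrix.sub_apply, h1, Matrix.smul_apply, gradedPart_apply, Int.cast_zero,
        add_zero, if_neg hd, smul_zero, sub_zero]
    rw [h2, zero_mul, mul_zero]

/-- The expansion of the correction up to the second order. -/
lemma lsCorrection_expansion (G : SimpleGraph V) {η : V → ℝ} {U h : ℝ} (t : ℝ)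
    (hη : ∀ x y, G.Adj x y → η y = -η x) (hη1 : ∀ x, η x * η x = 1) (hU : |h| < U)
    (s s' : HF V) :
    AnalyticAt ℝ (fun ξ : ℝ => lsCorrection G η U t h ξ s s') 0 ∧
      lsCorrection G η U t h 0 s s' = 0 ∧
      deriv (fun ξ : ℝ => lsCorrection G η U t h ξ s s') 0 = 0 ∧
      secondOrder G η U t h s s' = quadCoeff G η U t h s s' := by
  obtain ⟨F, hF, hF2⟩ :=
    matrix_iteration _ (hopping G t) _ _ (isHomologicalInverse_invAdLin η U h)
  have hre : Tendsto (fun ξ : ℝ => (ξ : ℂ)) (𝓝 0) (𝓝 0) := by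
    simpa using Complex.continuous_ofReal.tendsto 0
  have hgr : hopping G t - nonresPart η U h (hopping G t) = gradedPart 0 (hopping G t) := by
    ext u u'
    rw [Matrix.sub_apply, nonresPart_hopping_apply G t hη hη1 hU, gradedPart_apply, Int.cast_zero,
      add_zero]
    split_ifs <;> simp
  have heq : (fun ξ : ℝ => lsCorrection G η U t h ξ s s') =ᶠ[𝓝 0]
      fun ξ : ℝ => F ξ s s' - ξ * gradedPart 0 (hopping G t) s s' := by
    filter_upwards [hre.eventually hF] with ξ hξ
    have h1 : Tendsto (lsIter G η U t h ξ) atTop (𝓝 (F ξ)) :=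
      hξ.1.congr fun n => (lsIter_eq_iterate G η U t h ξ n).symm
    have h2 : lsLimit G η U t h ξ = F ξ := h1.limUnder_eq
    rw [lsCorrection, h2, Matrix.sub_apply, Matrix.smul_apply, smul_eq_mul]
  obtain ⟨han, hO⟩ := hF2 s s'
  have han' : AnalyticAt ℝ (fun ξ : ℝ => F ξ s s') 0 := by
    have h0 : AnalyticAt ℂ (fun ξ => F ξ s s') (Complex.ofRealCLM 0) := by simpa using han
    exact h0.restrictScalars.comp (Complex.ofRealCLM.analyticAt 0)
  have hcorr : AnalyticAt ℝ (fun ξ : ℝ => lsCorrection G η U t h ξ s s') 0 :=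
    (han'.sub ((Complex.ofRealCLM.analyticAt 0).mul analyticAt_const)).congr heq.symm
  have hO' : (fun ξ : ℝ => lsCorrection G η U t h ξ s s' -
      (ξ : ℂ) ^ 2 * quadCoeff G η U t h s s') =O[𝓝 0] fun ξ => ‖ξ‖ ^ 3 := by
    refine (hO.comp_tendsto hre).congr' ?_ (Eventually.of_forall fun ξ => by simp)
    filter_upwards [heq] with ξ hξ
    rw [hξ, ← hgr, quadCoeff]
    simp only [Function.comp]
    ring
  obtain ⟨h0, h1, h2⟩ := taylor_two_of_isBigO hcorr _ hO'
  exact ⟨hcorr, h0, h1, h2⟩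

/-- The second order term between singly occupied states, as a sum over intermediate states. -/
lemma quadCoeff_occHF_apply (G : SimpleGraph V) {η : V → ℝ} {U h : ℝ} (t : ℝ)
    (hη : ∀ x y, G.Adj x y → η y = -η x) (hη1 : ∀ x, η x * η x = 1) (hU : |h| < U)
    (σ τ : V → Fin 2) :
    quadCoeff G η U t h (occHF σ) (occHF τ) =
      ∑ u : HF V, hopSum G u.1 (occ σ) * hopSum G u.1 (occ τ) *
        (if dblCount u.1 = 0 then 0 else ((-(t ^ 2 / 2) *
          ((energy η U h u.1 - energy η U h (occ σ))⁻¹ +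
            (energy η U h u.1 - energy η U h (occ τ))⁻¹) : ℝ) : ℂ)) := by
  have hd : dblOcc (occHF σ) (occHF σ) = dblOcc (occHF τ) (occHF τ) := by
    rw [dblOcc_eq_iff]; simp [occHF, dblCount_occ]
  rw [quadCoeff, Matrix.sub_apply, nonresPart_apply, if_pos (Or.inl hd), sub_zero]
  simp only [quadTerm, Matrix.sub_apply, Matrix.smul_apply, Matrix.mul_apply, smul_eq_mul]
  rw [← Finset.sum_sub_distrib, ← Finset.sum_sub_distrib, Finset.mul_sum,
    ← Finset.sum_sub_distrib]
  refine Finset.sum_congr rfl fun u _ => ?_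
  simp only [nonresPart_hopping_apply G t hη hη1 hU, invAdLin_apply, hopping_apply,
    dblOcc_eq_iff, freeHam_self]
  rw [hopSum_symm G (occHF σ).1 u.1]
  simp only [occHF, dblCount_occ, eq_comm (a := 0)]
  by_cases hu : dblCount u.1 = 0
  · simp [hu]
  · simp only [hu, if_false]
    have e : ((energy η U h (occ σ) : ℂ) - energy η U h u.1)⁻¹ =
        -((energy η U h u.1 : ℂ) - energy η U h (occ σ))⁻¹ := by
      rw [← neg_sub, inv_neg]
    push_cast
    simp only [div_eq_mul_inv, e]
    ring

end SecondOrder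

/-! ### Comparison with the Heisenberg Hamiltonian -/

section Heisenberg

variable {V : Type} [Fintype V] [LinearOrder V]

lemma spinOp_mul_spinOp_apply (a b : Fin 3) {x y : V} (hxy : x ≠ y) (σ τ : V → Fin 2) :
    (spinOp a x * spinOp b y) σ τ = if ∀ z, z ≠ x → z ≠ y → σ z = τ z then
      (1 / 4 : ℂ) * (pauli a (σ x) (τ x) * pauli b (σ y) (τ y)) else 0 := by
  rw [Matrix.mul_apply, Finset.sum_eq_single (Function.update σ x (τ x))]
  · have h1 : ∀ z, z ≠ x → σ z = Function.update σ x (τ x) z := fun z hz => by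
      rw [Function.update_of_ne hz]
    have h2 : (∀ z, z ≠ y → Function.update σ x (τ x) z = τ z) ↔
        ∀ z, z ≠ x → z ≠ y → σ z = τ z := by
      refine ⟨fun h z hx hy => ?_, fun h z hy => ?_⟩
      · rw [← h z hy, Function.update_of_ne hx]
      · by_cases hx : z = x
        · subst hx; simp
        · rw [Function.update_of_ne hx, h z hx hy]
    simp only [spinOp, Matrix.of_apply]
    rw [if_pos h1, if_congr h2 rfl rfl, Function.update_self, Function.update_of_ne hxy.symm]
    split_ifs <;> ring
  · intro ρ _ hρ
    simp only [spinOp, Matrix.of_apply]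
    by_cases h1 : ∀ z, z ≠ x → σ z = ρ z
    · by_cases h2 : ∀ z, z ≠ y → ρ z = τ z
      · exact absurd (funext fun z => by
          by_cases hz : z = x
          · subst hz; rw [Function.update_self, h2 _ hxy]
          · rw [Function.update_of_ne hz, h1 z hz]) hρ
      · rw [if_neg h2, mul_zero]
    · rw [if_neg h1, zero_mul]
  · simp

/-- The Heisenberg interaction of a bond annihilates parallel spins, and on antiparallel spins it is
half the difference of the exchange and the identity. -/
lemma spinDot_sub_apply {x y : V} (hxy : x ≠ y) (σ τ : V → Fin 2) :
    (spinDot s(x, y) - (1 / 4 : ℂ) • (1 : Matrix (V → Fin 2) (V → Fin 2) ℂ)) σ τ =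
      if τ x ≠ τ y then
        (1 / 2 : ℂ) * ((if σ = swapSpin τ x y then 1 else 0) - if σ = τ then 1 else 0) else 0 := by
  have h1 : σ = τ ↔ (∀ z, z ≠ x → z ≠ y → σ z = τ z) ∧ σ x = τ x ∧ σ y = τ y := by
    refine ⟨fun h => by subst h; simp, fun h => funext fun z => ?_⟩
    by_cases hx : z = x
    · rw [hx, h.2.1]
    by_cases hy : z = y
    · rw [hy, h.2.2]
    exact h.1 z hx hy
  have h2 : σ = swapSpin τ x y ↔
      (∀ z, z ≠ x → z ≠ y → σ z = τ z) ∧ σ x = τ y ∧ σ y = τ x := by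
    refine ⟨fun h => ?_, fun h => funext fun z => ?_⟩
    · subst h
      refine ⟨fun z hx hy => ?_, swapSpin_left τ x y, swapSpin_right τ x y⟩
      simp [Equiv.swap_apply_of_ne_of_ne hx hy]
    by_cases hx : z = x
    · rw [hx, h.2.1, swapSpin_left]
    by_cases hy : z = y
    · rw [hy, h.2.2, swapSpin_right]
    rw [h.1 z hx hy]
    simp [Equiv.swap_apply_of_ne_of_ne hx hy]
  have h3 : (∀ z, z ≠ y → z ≠ x → σ z = τ z) ↔ ∀ z, z ≠ x → z ≠ y → σ z = τ z :=
    ⟨fun h z hx hy => h z hy hx, fun h z hx hy => h z hy hx⟩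
  simp only [spinDot, Sym2.lift_mk, Matrix.sub_apply, Matrix.smul_apply, Matrix.sum_apply,
    Matrix.add_apply, spinOp_mul_spinOp_apply _ _ hxy, spinOp_mul_spinOp_apply _ _ hxy.symm,
    Matrix.one_apply, smul_eq_mul, h1, h2, h3]
  by_cases hz : ∀ z, z ≠ x → z ≠ y → σ z = τ z
  · simp only [if_pos hz, and_iff_right hz, Fin.sum_univ_three]
    generalize σ x = a
    generalize σ y = b
    generalize τ x = a'
    generalize τ y = b'
    fin_cases a <;> fin_cases b <;> fin_cases a' <;> fin_cases b' <;>
      simp [pauli] <;> ring_nf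
  · simp [hz]

lemma spinOp_two_apply (x : V) (σ τ : V → Fin 2) :
    spinOp 2 x σ τ = if σ = τ then ((spinSign (τ x) / 2 : ℝ) : ℂ) else 0 := by
  simp only [spinOp, Matrix.of_apply]
  by_cases h : σ = τ
  · subst h
    simp only [implies_true, if_true]
    generalize σ x = a
    fin_cases a <;> simp [pauli, spinSign]; ring
  · rw [if_neg h]
    split_ifs with h1
    · have h2 : σ x ≠ τ x := fun h2 => h (funext fun z => by
        by_cases hz : z = x
        · rw [hz, h2]
        · exact h1 z hz)
      revert h2
      generalize σ x = a
      generalize τ x = b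
      intro h2
      fin_cases a <;> fin_cases b <;> simp_all [pauli]
    · rfl

/-- The contribution of one ordered pair of neighbours to the second order term: half of the
Heisenberg interaction of the bond and a correction to the staggered field at its ends. -/
lemma hop_contribution {η : V → ℝ} {U h : ℝ} (t : ℝ) (hη1 : ∀ x, η x * η x = 1) (hU : |h| < U)
    {x y : V} (hne : x ≠ y) (hη : η y = -η x) (σ τ : V → Fin 2) :
    (if τ x ≠ τ y then
        ((if σ = τ then 1 else 0) - if σ = swapSpin τ x y then 1 else 0) *
          (if dblCount (hopSet τ x y) = 0 then 0 else ((-(t ^ 2 / 2) *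
            ((energy η U h (hopSet τ x y) - energy η U h (occ σ))⁻¹ +
              (energy η U h (hopSet τ x y) - energy η U h (occ τ))⁻¹) : ℝ) : ℂ))
      else 0) =
      ((2 * t ^ 2 * U / (U ^ 2 - h ^ 2) : ℝ) : ℂ) *
          (spinDot s(x, y) - (1 / 4 : ℂ) • (1 : Matrix (V → Fin 2) (V → Fin 2) ℂ)) σ τ +
        (if σ = τ then 1 else 0) * ((t ^ 2 * h / (U ^ 2 - h ^ 2) / 2 *
          (η x * spinSign (τ x) + η y * spinSign (τ y)) : ℝ) : ℂ) := by
  rw [spinDot_sub_apply hne]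
  obtain ⟨b1, b2⟩ := abs_lt.1 hU
  have hden : U ^ 2 - h ^ 2 ≠ 0 := by nlinarith
  by_cases hτ : τ x ≠ τ y
  swap
  · rw [if_neg hτ, if_neg hτ, hη, not_not.1 hτ]
    simp
  rw [if_pos hτ, if_pos hτ, dblCount_hopSet hτ, if_neg one_ne_zero, energy_hopSet η U h hτ hη,
    spinSign_of_ne hτ, hη]
  set a := η x * spinSign (τ y) with ha
  have ha1 : a * a = 1 := by
    rw [ha, mul_mul_mul_comm, hη1, spinSign_sq, one_mul]
  have hfac : (U - h * a) * (U + h * a) = U ^ 2 - h ^ 2 := by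
    linear_combination -h ^ 2 * ha1
  have hm : U - h * a ≠ 0 := fun h0 => hden (by rw [← hfac, h0, zero_mul])
  have hp : U + h * a ≠ 0 := fun h0 => hden (by rw [← hfac, h0, mul_zero])
  have him : (U - h * a)⁻¹ = (U + h * a) / (U ^ 2 - h ^ 2) := by
    rw [← hfac]; field_simp
  have hip : (U + h * a)⁻¹ = (U - h * a) / (U ^ 2 - h ^ 2) := by
    rw [← hfac]; field_simp
  have hne' : τ ≠ swapSpin τ x y := fun h => hτ (by
    have := congrFun h x
    rwa [swapSpin_left] at this)
  have e2 : t ^ 2 * h / (U ^ 2 - h ^ 2) / 2 * (η x * -spinSign (τ y) + -η x * spinSign (τ y)) =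
      -(t ^ 2 * h * a / (U ^ 2 - h ^ 2)) := by
    rw [ha]; ring
  rw [e2]
  by_cases h1 : σ = τ
  · rw [if_pos h1, h1, if_neg hne', add_sub_cancel_left, him]
    push_cast
    ring
  · by_cases h2 : σ = swapSpin τ x y
    · have hσ : swapSpin τ x y x ≠ swapSpin τ x y y := by
        rw [swapSpin_left, swapSpin_right]; exact hτ.symm
      have e3 := energy_hopSet η U h hσ hη
      rw [hopSet_swapSpin hτ, swapSpin_right, spinSign_of_ne hτ, energy_hopSet η U h hτ hη] at e3
      have e4 : energy η U h (occ τ) + (U - h * a) - energy η U h (occ (swapSpin τ x y)) =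
          U + h * a := by
        rw [ha]; linarith
      rw [if_neg h1, if_pos h2, h2, e4, add_sub_cancel_left, him, hip]
      push_cast
      ring
    · simp [h1, h2]

/-- Second order perturbation theory yields the Heisenberg Hamiltonian on a bipartite regular
graph of degree `k`. -/
lemma spinIdent_effective_eq_heisenberg (G : SimpleGraph V) [DecidableRel G.Adj] {η : V → ℝ}
    {U h : ℝ} (t : ℝ) (hη : ∀ x y, G.Adj x y → η y = -η x) (hη1 : ∀ x, η x * η x = 1)
    (hU : |h| < U) (k : ℕ) (hk : ∀ x, (Finset.univ.filter fun y => G.Adj x y).card = k) :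
    (spinIdent (V := V)) *
        (specProj 0 * (-(h : ℂ) • stagMag η + secondOrder G η U t h) * specProj 0) *
        (spinIdent (V := V))ᴴ =
      heisenberg G η (4 * t ^ 2 * U / (U ^ 2 - h ^ 2))
        (h - 2 * k * h * t ^ 2 / (U ^ 2 - h ^ 2)) := by
  classical
  ext σ τ
  rw [spinIdent_conj_apply, specProj_zero_conj_apply, Matrix.add_apply,
    (lsCorrection_expansion G t hη hη1 hU _ _).2.2.2, quadCoeff_occHF_apply G t hη hη1 hU,
    sum_hopSum_mul_hopSum G σ τ fun u => if dblCount u = 0 then 0 else ((-(t ^ 2 / 2) *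
          ((energy η U h u - energy η U h (occ σ))⁻¹ +
            (energy η U h u - energy η U h (occ τ))⁻¹) : ℝ) : ℂ)]
  set c : ℝ := t ^ 2 * h / (U ^ 2 - h ^ 2) / 2 with hc
  set δ : ℂ := if σ = τ then 1 else 0 with hδ
  set g : V → ℝ := fun x => η x * spinSign (τ x) with hg
  have hmag : stagMag η (occHF σ) (occHF τ) = δ * ((∑ x, g x / 2 : ℝ) : ℂ) := by
    by_cases h1 : σ = τ
    · rw [hδ, if_pos h1, h1, one_mul, stagMag_self]
      exact congrArg _ (magCount_occ η τ)
    · rw [hδ, if_neg h1, zero_mul]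
      exact stagMag_isDiag η fun h2 => h1 (occ_injective (congrArg Subtype.val h2))
  have hpair : ∀ x y, (if G.Adj x y ∧ τ x ≠ τ y then
        (δ - if σ = swapSpin τ x y then 1 else 0) *
          (if dblCount (hopSet τ x y) = 0 then 0 else ((-(t ^ 2 / 2) *
            ((energy η U h (hopSet τ x y) - energy η U h (occ σ))⁻¹ +
              (energy η U h (hopSet τ x y) - energy η U h (occ τ))⁻¹) : ℝ) : ℂ))
      else 0) =
      ((2 * t ^ 2 * U / (U ^ 2 - h ^ 2) : ℝ) : ℂ) * (if G.Adj x y then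
          (spinDot s(x, y) - (1 / 4 : ℂ) • (1 : Matrix (V → Fin 2) (V → Fin 2) ℂ)) σ τ else 0) +
        δ * ((c * ((if G.Adj x y then g x else 0) + if G.Adj x y then g y else 0) : ℝ) : ℂ) := by
    intro x y
    by_cases hxy : G.Adj x y
    · have := hop_contribution t hη1 hU hxy.ne (hη x y hxy) σ τ
      simp only [hxy, true_and, if_true]
      exact this
    · simp [hxy]
  have hsum1 : ∑ x, ∑ y, (if G.Adj x y then g x else 0) = k * ∑ x, g x := by
    rw [Finset.mul_sum]
    refine Finset.sum_congr rfl fun x _ => ?_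
    rw [← Finset.sum_filter, Finset.sum_const, hk, nsmul_eq_mul]
  have hsum2 : ∑ x, ∑ y, (if G.Adj x y then g y else 0) = k * ∑ x, g x := by
    rw [Finset.sum_comm, ← hsum1]
    simp only [G.adj_comm]
  have hsum3 := sum_adj_eq_two_nsmul G fun e =>
    (spinDot e - (1 / 4 : ℂ) • (1 : Matrix (V → Fin 2) (V → Fin 2) ℂ)) σ τ
  have hsum4 : ∑ x, ∑ y, (c * ((if G.Adj x y then g x else 0) + if G.Adj x y then g y else 0)) =
      c * (2 * k * ∑ x, g x) := by
    simp only [← Finset.mul_sum, Finset.sum_add_distrib, hsum1, hsum2]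
    ring
  have hheis : heisenberg G η (4 * t ^ 2 * U / (U ^ 2 - h ^ 2))
      (h - 2 * k * h * t ^ 2 / (U ^ 2 - h ^ 2)) σ τ =
      ((4 * t ^ 2 * U / (U ^ 2 - h ^ 2) : ℝ) : ℂ) * ∑ e ∈ G.edgeFinset,
        (spinDot e - (1 / 4 : ℂ) • (1 : Matrix (V → Fin 2) (V → Fin 2) ℂ)) σ τ -
      ((h - 2 * k * h * t ^ 2 / (U ^ 2 - h ^ 2) : ℝ) : ℂ) * (δ * ((∑ x, g x / 2 : ℝ) : ℂ)) := by
    have hz : ∑ x, (η x : ℂ) * spinOp 2 x σ τ = δ * ((∑ x, g x / 2 : ℝ) : ℂ) := by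
      rw [Complex.ofReal_sum, Finset.mul_sum]
      refine Finset.sum_congr rfl fun x _ => ?_
      rw [spinOp_two_apply, hδ, hg]
      split_ifs
      · push_cast; ring
      · simp
    simp only [heisenberg, Matrix.sub_apply, Matrix.smul_apply, Matrix.sum_apply, smul_eq_mul]
    rw [hz]
    congr!
  rw [hheis, Matrix.smul_apply, smul_eq_mul, hmag]
  rw [Finset.sum_congr rfl fun x _ => Finset.sum_congr rfl fun y _ => hpair x y]
  simp only [Finset.sum_add_distrib (M := ℂ), ← Finset.mul_sum (R := ℂ), ← Complex.ofReal_sum]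
  rw [hsum3, hsum4, ← Finset.sum_div, hc, nsmul_eq_mul]
  push_cast
  ring

end Heisenberg

/-! ### The torus -/

section Torus

lemma neg_one_pow_val_add_one {L : ℕ} [NeZero L] (hL : Even L) (a : ZMod L) :
    (-1 : ℝ) ^ (a + 1).val = -(-1) ^ a.val := by
  have h1 : ∀ n : ℕ, (-1 : ℝ) ^ (n % L) = (-1) ^ n := fun n => by
    conv_rhs => rw [← Nat.mod_add_div n L]
    rw [pow_add, pow_mul, hL.neg_one_pow, one_pow, mul_one]
  have h2 : (a + 1).val = (a.val + 1) % L := by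
    have : a + 1 = ((a.val + 1 : ℕ) : ZMod L) := by simp
    rw [this, ZMod.val_natCast]
  rw [h2, h1, pow_succ, mul_neg_one]

lemma stagger_add_single {d L : ℕ} [NeZero L] (hL : Even L) (x : Torus d L) (i : Fin d) :
    stagger d L (x + Pi.single i 1) = -stagger d L x := by
  simp only [stagger, ← Finset.prod_pow_eq_pow_sum]
  rw [← Finset.mul_prod_erase _ _ (Finset.mem_univ i), ← Finset.mul_prod_erase _
    (fun j => (-1 : ℝ) ^ (x j).val) (Finset.mem_univ i), ← neg_mul]
  congr 1
  · simp [neg_one_pow_val_add_one hL]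
  · refine Finset.prod_congr rfl fun j hj => ?_
    simp [Pi.single_eq_of_ne (Finset.ne_of_mem_erase hj)]

lemma stagger_mul_self (d L : ℕ) (x : Torus d L) : stagger d L x * stagger d L x = 1 := by
  rw [stagger, ← mul_pow]; simp

lemma stagger_of_adj {d L : ℕ} [NeZero L] (hL : Even L) (x y : Torus d L)
    (h : (torusGraph d L).Adj x y) : stagger d L y = -stagger d L x := by
  rw [torusGraph, SimpleGraph.fromRel_adj] at h
  obtain ⟨-, ⟨i, rfl⟩ | ⟨i, rfl⟩⟩ := h
  · exact stagger_add_single hL x i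
  · rw [stagger_add_single hL, neg_neg]

/-- Each site of the torus has `2 d` neighbours; this needs `L ≥ 3`, so that the two neighbours in
each direction are different. -/
lemma card_neighbors_torus {d L : ℕ} [NeZero L] (hL : 3 ≤ L)
    [DecidableRel (torusGraph d L).Adj] (x : Torus d L) :
    (Finset.univ.filter fun y => (torusGraph d L).Adj x y).card = 2 * d := by
  have h1 : (1 : ZMod L) ≠ 0 := by
    have : Fact (1 < L) := ⟨by omega⟩
    exact one_ne_zero
  have h2 : (1 : ZMod L) ≠ -1 := by
    have : Fact (2 < L) := ⟨by omega⟩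
    exact (ZMod.neg_one_ne_one (n := L)).symm
  have hs : ∀ b : Bool, (if b then 1 else -1 : ZMod L) ≠ 0 := by
    rintro (_ | _) <;> simp [h1]
  have hcard : (Finset.univ : Finset (Fin d × Bool)).card = 2 * d := by
    simp [mul_comm]
  rw [← hcard]
  symm
  refine Finset.card_bij
    (fun p _ => x + Pi.single p.1 (if p.2 then 1 else -1 : ZMod L)) ?_ ?_ ?_
  · rintro ⟨i, b⟩ -
    rw [Finset.mem_filter, torusGraph, SimpleGraph.fromRel_adj]
    refine ⟨Finset.mem_univ _, fun h => ?_, ?_⟩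
    · have := congrFun h i
      simp only [Pi.add_apply, Pi.single_eq_same, left_eq_add] at this
      exact hs b this
    · cases b
      · right
        refine ⟨i, ?_⟩
        simp [add_assoc, ← Pi.single_add]
      · left
        exact ⟨i, by simp⟩
  · rintro ⟨i, b⟩ - ⟨j, c⟩ - h
    have h' := add_left_cancel h
    have hij : i = j := by
      by_contra hne
      have := congrFun h' i
      simp only [Pi.single_eq_same, Pi.single_eq_of_ne hne] at this
      exact hs b this
    subst hij
    have hbc := Pi.single_injective _ h'
    cases b <;> cases c <;> simp_all
  · intro y hy
    rw [Finset.mem_filter, torusGraph, SimpleGraph.fromRel_adj] at hy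
    obtain ⟨-, -, ⟨i, rfl⟩ | ⟨i, rfl⟩⟩ := hy
    · exact ⟨(i, true), Finset.mem_univ _, by simp⟩
    · refine ⟨(i, false), Finset.mem_univ _, ?_⟩
      simp [add_assoc, ← Pi.single_add]

end Torus

end Hubbard

end

theorem mainTheorem6 (d L : ℕ) [NeZero L] (hd : 1 ≤ d) (hL : Even L) (hL4 : 4 ≤ L)
    [LinearOrder (Torus d L)] (U t h : ℝ) (hU : |h| < U) :
    -- the iteration converges for small `ξ`
    (∀ᶠ ξ : ℝ in 𝓝 0, Tendsto
      (lsIter (torusGraph d L) (stagger d L) U t h ξ) atTop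
      (𝓝 (lsLimit (torusGraph d L) (stagger d L) U t h ξ))) ∧
    -- the correction is diagonal with respect to `D` if no energy denominator vanishes
    ((∀ s s' : HF (Torus d L),
        dblOcc s s ≠ dblOcc s' s' →
        freeHam (stagger d L) U h s s ≠
          freeHam (stagger d L) U h s' s') →
      ∀ᶠ ξ : ℝ in 𝓝 0, Commute
        (lsCorrection (torusGraph d L) (stagger d L) U t h ξ)
        dblOcc) ∧
    -- the correction is analytic at `ξ = 0` and its expansion starts at the second order
    (∀ s s' : HF (Torus d L),
      AnalyticAt ℝ (fun ξ : ℝ =>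
        lsCorrection (torusGraph d L) (stagger d L) U t h ξ s s') 0 ∧
      lsCorrection (torusGraph d L) (stagger d L) U t h 0 s s' = 0 ∧
      deriv (fun ξ : ℝ =>
        lsCorrection (torusGraph d L) (stagger d L) U t h ξ s s') 0 = 0) ∧
    -- the spin identification is unitary from the range of `P` onto the spin space
    ((spinIdent (V := Torus d L)) * (spinIdent (V := Torus d L))ᴴ = 1 ∧
      (spinIdent (V := Torus d L))ᴴ * (spinIdent (V := Torus d L)) = specProj 0) ∧
    -- the second-order block is the Heisenberg Hamiltonian
    (spinIdent (V := Torus d L)) *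
        (specProj 0 *
          (-(h : ℂ) • stagMag (stagger d L) +
            secondOrder (torusGraph d L) (stagger d L) U t h) *
          specProj 0) * (spinIdent (V := Torus d L))ᴴ =
      heisenberg (torusGraph d L) (stagger d L)
        (4 * t ^ 2 * U / (U ^ 2 - h ^ 2)) (h - 4 * d * h * t ^ 2 / (U ^ 2 - h ^ 2)) := by
  classical
  have hη := stagger_of_adj (d := d) hL
  have hη1 := stagger_mul_self d L
  refine ⟨?_, ?_, ?_, ?_, ?_⟩
  · exact (eventually_tendsto_lsLimit _ _ U t h).mono fun ξ hξ => hξ.1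
  · exact eventually_commute_lsCorrection _ _ U t h
  · intro s s'
    obtain ⟨h1, h2, h3, -⟩ := lsCorrection_expansion (torusGraph d L) t hη hη1 hU s s'
    exact ⟨h1, h2, h3⟩
  · exact ⟨spinIdent_mul_conjTranspose, spinIdent_conjTranspose_mul⟩
  · have hk := spinIdent_effective_eq_heisenberg (torusGraph d L) t hη hη1 hU (2 * d)
      fun x => card_neighbors_torus (by omega) x
    have e : h - 4 * d * h * t ^ 2 / (U ^ 2 - h ^ 2) =
        h - 2 * (2 * d : ℕ) * h * t ^ 2 / (U ^ 2 - h ^ 2) := by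
      push_cast
      ring
    rw [e]
    exact hk
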